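/- Let $\nu>2$, $\lambda>0$ and $p>\frac{\nu+2}{\nu-2}$ be real numbers. For each $\alpha>0$ the initial value problem $$u''(r)+(\nu-1)\frac{u'(r)}{r}=-\frac{u(r)^p}{\lambda}\quad (r>1),\qquad u(1)=0,\quad u'(1)=\alpha,$$ has a unique maximal positive solution $u_\alpha$, i.e. a solution with $u_\alpha>0$ on $(1,\rho_\alpha)$, defined on a maximal interval $[1,\rho_\alpha)$ with $1<\rho_\alpha\le+\infty$. The set $D=\{\alpha>0:\rho_\alpha<+\infty\}$ is nonempty; put $\alpha^*=\inf D$. Then: (i) $\alpha^*>0$; (ii) if $\alpha>\alpha^*$, then $\rho_\alpha<+\infty$, and $u_\alpha(r)\to 0$ as $r\to\rho_\alpha^-$; (iii) $\rho_{\alpha^*}=+\infty$ and $\lim_{r\to+\infty}r^{\nu-2}u_{\alpha^*}(r)=C$ for some constant $C>0$; moreover $\alpha^*$ is the only $\alpha>0$ such that $\rho_\alpha=+\infty$ and $\lim_{r\to+\infty}r^{\nu-2}u_\alpha(r)$ exists in $(0,+\infty)$; (iv) if $0<\alpha<\alpha^*$, then $\rho_\alpha=+\infty$ and $$\lim_{r\to+\infty}r^{\frac{2}{p-1}}u_\alpha(r)=\left(\frac{2\lambda\,((\nu-2)p-\nu)}{(p-1)^2}\right)^{\frac1{p-1}}.$$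 -/

import Mathlib

open Filter Topology Set

/-- `u` is a positive solution on `[1, ρ)`, `1 < ρ ≤ +∞`, of
`u'' + (ν - 1) u' / r = - u ^ p / lam` for `r > 1`, `u(1) = 0`, `u'(1) = α`.
The function `v` is the derivative `u'`, one-sided and continuous at `r = 1`.
Values of `u` outside `[1, ρ)` are irrelevant. -/
structure IsPositiveSolution (ν p lam α : ℝ) (ρ : EReal) (u : ℝ → ℝ) : Prop where
  one_lt : 1 < ρ
  pos : ∀ r : ℝ, 1 < r → (r : EReal) < ρ → 0 < u r
  initial : u 1 = 0
  ode : ∃ v : ℝ → ℝ,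
    (∀ r : ℝ, 1 ≤ r → (r : EReal) < ρ → HasDerivWithinAt u (v r) (Ici 1) r) ∧
    v 1 = α ∧ ContinuousWithinAt v (Ici 1) 1 ∧
    ∀ r : ℝ, 1 < r → (r : EReal) < ρ →
      ∃ w : ℝ, HasDerivAt v w r ∧ w + (ν - 1) * (v r / r) = -(u r ^ p / lam)

/-- `u` on `[1, ρ)` is a maximal positive solution: it is a positive solution and no positive
solution on a strictly larger interval `[1, ρ')` extends it. -/
structure IsMaximalPositiveSolution (ν p lam α : ℝ) (ρ : EReal) (u : ℝ → ℝ) : Prop where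
  sol : IsPositiveSolution ν p lam α ρ u
  maximal : ∀ (ρ' : EReal) (w : ℝ → ℝ), IsPositiveSolution ν p lam α ρ' w → ρ ≤ ρ' →
    (∀ r : ℝ, 1 ≤ r → (r : EReal) < ρ → w r = u r) → ρ' = ρ

/-- The set of the slopes `α > 0` whose maximal positive solution lives on a bounded interval. -/
def crossingSlopes (ν p lam : ℝ) : Set ℝ :=
  {α | 0 < α ∧ ∃ (ρ : EReal) (u : ℝ → ℝ), IsMaximalPositiveSolution ν p lam α ρ u ∧ ρ < ⊤}

/-- The critical slope `α^*`. -/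
noncomputable def criticalSlope (ν p lam : ℝ) : ℝ := sInf (crossingSlopes ν p lam)

/-!
Let `m = 2 / (p - 1)`. The Emden–Fowler substitution `x(t) = r ^ m u(r)`, `r = exp t`, turns the
radial equation into the autonomous oscillator `x'' + d x' + f(x) = 0`, where the damping `d` is
positive because `p` is supercritical and `f` is the force of a potential well with a single
minimum in `x > 0`. The initial slope `α` becomes the initial velocity at `x = 0`, where the
potential energy is `0`.

The energy decreases along trajectories. Hence a trajectory either passes through `x = 0` again and
stays in `x < 0` (the solution crosses), or attains negative energy and then converges to the bottom
of the well (slow decay), or converges to the origin with nonnegative energy (fast decay). The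
slopes of the first two kinds form disjoint open sets; the first contains a large slope and the
second all small ones. Two trajectories of the third kind approach the origin in the phase plane
along velocity graphs whose difference cannot shrink towards the origin, although both velocities
tend to `0` there; so the graphs coincide, and with them the slopes. By connectedness of `(0, ∞)`
the single slope of the third kind separates the other two.
-/

/-! ### Topology and real analysis -/

lemma apply_eq_of_mapClusterPt {ι X Y : Type*} [TopologicalSpace X] [TopologicalSpace Y] [T2Space Y]
    {l : Filter ι} {u : ι → X} {G : X → Y} {z : X} {L : Y} (hG : ContinuousAt G z)
    (hz : MapClusterPt z l u) (hL : Tendsto (G ∘ u) l (𝓝 L)) : G z = L :=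
  eq_of_nhds_neBot ((hz.continuousAt_comp hG).neBot.mono (inf_le_inf_left _ hL))

lemma exists_threshold {U V : Set ℝ} {b : ℝ} (hU : IsOpen U) (hV : IsOpen V)
    (hUV : ∀ a > b, a ∈ U → a ∉ V) (hnear : ∃ ε > b, Ioo b ε ⊆ V) (hfar : ∃ A > b, A ∈ U)
    (hrest : ∀ a > b, ∀ c > b, a ∉ U → a ∉ V → c ∉ U → c ∉ V → a = c) :
    ∃ a > b, a ∉ U ∧ a ∉ V ∧ Ioi a ⊆ U ∧ Ioo b a ⊆ V := by
  obtain ⟨ε, hε, hεV⟩ := hnear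
  obtain ⟨A, hA, hAU⟩ := hfar
  have hsplit {s : Set ℝ} (hsb : s ⊆ Ioi b) (hs : IsPreconnected s) (hcover : s ⊆ U ∪ V) :
      s ⊆ U ∨ s ⊆ V := by
    have hdisj : Disjoint (U ∩ Ioi b) (V ∩ Ioi b) :=
      disjoint_left.2 fun a haU haV => hUV a haU.2 haU.1 haV.1
    exact (hs.subset_or_subset (hU.inter isOpen_Ioi) (hV.inter isOpen_Ioi) hdisj
      fun a ha => (hcover ha).imp (⟨·, hsb ha⟩) (⟨·, hsb ha⟩)).imp
        (·.trans inter_subset_left) (·.trans inter_subset_left)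
  have hVnear {c : ℝ} (hc : b < c) : ∃ a ∈ Ioo b c, a ∈ V := by
    obtain ⟨a, hba, ha⟩ := exists_between (lt_min hc hε)
    exact ⟨a, ⟨hba, ha.trans_le (min_le_left _ _)⟩, hεV ⟨hba, ha.trans_le (min_le_right _ _)⟩⟩
  obtain ⟨a, hab, haUV⟩ : ∃ a > b, a ∉ U ∪ V := by
    by_contra! hcover
    rcases hsplit Subset.rfl isPreconnected_Ioi hcover with hsub | hsub
    · obtain ⟨a, ha, haV⟩ := hVnear hA
      exact hUV a ha.1 (hsub ha.1) haV
    · exact hUV A hA hAU (hsub hA)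
  have haU : a ∉ U := fun h => haUV (Or.inl h)
  have haV : a ∉ V := fun h => haUV (Or.inr h)
  have hcover : ∀ c > b, c ≠ a → c ∈ U ∪ V := fun c hc hca => by
    by_contra! hcUV
    exact hca (hrest c hc a hab (fun h => hcUV (Or.inl h)) (fun h => hcUV (Or.inr h)) haU haV)
  have hbelow : Ioo b a ⊆ V := by
    refine (hsplit Ioo_subset_Ioi_self isPreconnected_Ioo
      fun c hc => hcover c hc.1 hc.2.ne).resolve_left fun hsub => ?_
    obtain ⟨c, hc, hcV⟩ := hVnear hab
    exact hUV c hc.1 (hsub hc) hcV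
  refine ⟨a, hab, haU, haV, ?_, hbelow⟩
  refine (hsplit (Ioi_subset_Ioi hab.le) isPreconnected_Ioi
    fun c hc => hcover c (hab.trans hc) (ne_of_gt hc)).resolve_right fun hsub => ?_
  rcases lt_trichotomy A a with hlt | rfl | hlt
  exacts [hUV A hA hAU (hbelow ⟨hA, hlt⟩), haU hAU, hUV A hA hAU (hsub hlt)]

section RealFunctions

variable {f f' : ℝ → ℝ} {D : Set ℝ}

lemma antitoneOn_of_forall_hasDerivWithinAt (hD : Convex ℝ D)
    (hf : ∀ t ∈ D, HasDerivWithinAt f (f' t) D t) (hf' : ∀ t ∈ D, f' t ≤ 0) : AntitoneOn f D :=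
  antitoneOn_of_hasDerivWithinAt_nonpos hD (fun t ht => (hf t ht).continuousWithinAt)
    (fun t ht => (hf t (interior_subset ht)).mono interior_subset)
    (fun t ht => hf' t (interior_subset ht))

lemma monotoneOn_of_forall_hasDerivWithinAt (hD : Convex ℝ D)
    (hf : ∀ t ∈ D, HasDerivWithinAt f (f' t) D t) (hf' : ∀ t ∈ D, 0 ≤ f' t) : MonotoneOn f D :=
  monotoneOn_of_hasDerivWithinAt_nonneg hD (fun t ht => (hf t ht).continuousWithinAt)
    (fun t ht => (hf t (interior_subset ht)).mono interior_subset)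
    (fun t ht => hf' t (interior_subset ht))

lemma strictAntiOn_of_forall_hasDerivWithinAt (hD : Convex ℝ D)
    (hf : ∀ t ∈ D, HasDerivWithinAt f (f' t) D t) (hf' : ∀ t ∈ D, f' t < 0) : StrictAntiOn f D :=
  strictAntiOn_of_hasDerivWithinAt_neg hD (fun t ht => (hf t ht).continuousWithinAt)
    (fun t ht => (hf t (interior_subset ht)).mono interior_subset)
    (fun t ht => hf' t (interior_subset ht))

lemma strictMonoOn_of_forall_hasDerivWithinAt (hD : Convex ℝ D)
    (hf : ∀ t ∈ D, HasDerivWithinAt f (f' t) D t) (hf' : ∀ t ∈ D, 0 < f' t) : StrictMonoOn f D :=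
  strictMonoOn_of_hasDerivWithinAt_pos hD (fun t ht => (hf t ht).continuousWithinAt)
    (fun t ht => (hf t (interior_subset ht)).mono interior_subset)
    (fun t ht => hf' t (interior_subset ht))

lemma exists_tendsto_of_monotoneOn_Ici {T B : ℝ} (hf : MonotoneOn f (Ici T))
    (hB : ∀ t, T ≤ t → f t ≤ B) :
    ∃ L, Tendsto f atTop (𝓝 L) ∧ ∀ t, T ≤ t → f t ≤ L := by
  have hmono : Monotone fun t => f (max t T) := fun s t hst =>
    hf (mem_Ici.2 (le_max_right _ _)) (mem_Ici.2 (le_max_right _ _)) (max_le_max_right _ hst)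
  have hbdd : BddAbove (range fun t => f (max t T)) :=
    ⟨B, forall_mem_range.2 fun t => hB _ (le_max_right _ _)⟩
  refine ⟨_, (tendsto_atTop_ciSup hmono hbdd).congr' ?_, fun t ht => ?_⟩
  · filter_upwards [eventually_ge_atTop T] with t ht
    rw [max_eq_left ht]
  · simpa [max_eq_left ht] using le_ciSup hbdd t

lemma exists_tendsto_of_antitoneOn_Ici {T B : ℝ} (hf : AntitoneOn f (Ici T))
    (hB : ∀ t, T ≤ t → B ≤ f t) :
    ∃ L, Tendsto f atTop (𝓝 L) ∧ ∀ t, T ≤ t → L ≤ f t := by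
  obtain ⟨L, hL, hle⟩ := exists_tendsto_of_monotoneOn_Ici hf.neg fun t ht => neg_le_neg (hB t ht)
  exact ⟨-L, by simpa using hL.neg, fun t ht => neg_le.2 (hle t ht)⟩

lemma exists_first_zero {a b : ℝ} (hf : ContinuousOn f (Icc a b)) (hab : a ≤ b)
    (ha : 0 < f a) (hb : f b ≤ 0) : ∃ s ∈ Ioc a b, f s = 0 ∧ ∀ t ∈ Ico a s, 0 < f t := by
  have hzero {t : ℝ} (ht : t ∈ Icc a b) (hft : f t ≤ 0) : ∃ r ∈ Icc a t, f r = 0 :=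
    intermediate_value_Icc' ht.1 (hf.mono (Icc_subset_Icc_right ht.2)) ⟨hft, ha.le⟩
  have hcompact : IsCompact (Icc a b ∩ f ⁻¹' {0}) := isCompact_Icc.of_isClosed_subset
    (hf.preimage_isClosed_of_isClosed isClosed_Icc isClosed_singleton) inter_subset_left
  obtain ⟨r, hr, hfr⟩ := hzero (right_mem_Icc.2 hab) hb
  obtain ⟨s, ⟨hs, hfs⟩, hleast⟩ := hcompact.exists_isLeast ⟨r, hr, hfr⟩
  have hfs : f s = 0 := hfs
  refine ⟨s, ⟨hs.1.lt_of_ne ?_, hs.2⟩, hfs, fun t ht => ?_⟩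
  · rintro rfl
    exact ha.ne' hfs
  · by_contra! hft
    obtain ⟨q, hq, hfq⟩ := hzero ⟨ht.1, ht.2.le.trans hs.2⟩ hft
    exact (hleast ⟨⟨hq.1, hq.2.trans (ht.2.le.trans hs.2)⟩, hfq⟩).not_gt (hq.2.trans_lt ht.2)

/-- Barbalat's lemma. -/
lemma tendsto_zero_of_uniformContinuousOn_deriv {T L : ℝ} (hf : Tendsto f atTop (𝓝 L))
    (hd : ∀ t ∈ Ici T, HasDerivWithinAt f (f' t) (Ici T) t)
    (hf' : UniformContinuousOn f' (Ici T)) : Tendsto f' atTop (𝓝 0) := by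
  rw [Metric.tendsto_atTop]
  intro ε hε
  obtain ⟨δ, hδ, hclose⟩ := Metric.uniformContinuousOn_iff.1 hf' (ε / 2) (by positivity)
  have hshift : Tendsto (fun t => f (t + δ / 2) - f t) atTop (𝓝 0) := by
    simpa using (hf.comp (tendsto_atTop_add_const_right _ (δ / 2) tendsto_id)).sub hf
  obtain ⟨N, hN⟩ := Metric.tendsto_atTop.1 hshift (δ / 2 * (ε / 2)) (by positivity)
  refine ⟨max N T, fun t ht => ?_⟩
  have hTt : T ≤ t := (le_max_right _ _).trans ht
  obtain ⟨ξ, hξ, hslope⟩ := exists_hasDerivAt_eq_slope f f' (by linarith : t < t + δ / 2)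
    (fun s hs => (hd s (hTt.trans hs.1)).continuousWithinAt.mono fun r hr => hTt.trans hr.1)
    (fun s hs => (hd s (hTt.trans hs.1.le)).hasDerivAt (Ici_mem_nhds (hTt.trans_lt hs.1)))
  have hmean : |f' ξ| < ε / 2 := by
    have hinc := hN t ((le_max_left _ _).trans ht)
    rw [Real.dist_eq, sub_zero] at hinc
    rwa [hslope, add_sub_cancel_left, abs_div, abs_of_pos (by positivity : 0 < δ / 2),
      div_lt_iff₀' (by positivity)]
  have hnear : dist (f' t) (f' ξ) < ε / 2 := by
    refine hclose t hTt ξ (hTt.trans hξ.1.le) ?_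
    rw [Real.dist_eq, abs_sub_comm, abs_of_pos (by linarith [hξ.1])]
    linarith [hξ.2]
  calc dist (f' t) 0 ≤ dist (f' t) (f' ξ) + dist (f' ξ) 0 := dist_triangle _ _ _
    _ < ε / 2 + ε / 2 := add_lt_add hnear (by simpa [Real.dist_eq] using hmean)
    _ = ε := add_halves ε

lemma hasDerivAt_max_zero_rpow {q : ℝ} (hq : 1 < q) (x : ℝ) :
    HasDerivAt (fun x : ℝ => (max x 0) ^ q) (q * (max x 0) ^ (q - 1)) x := by
  have hleft : ∀ x ≤ 0, HasDerivWithinAt (fun x : ℝ => (max x 0) ^ q) 0 (Iic 0) x := fun x hx =>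
    (hasDerivWithinAt_const x _ 0).congr
      (fun t ht => by rw [max_eq_right ht, Real.zero_rpow (by linarith)])
      (by rw [max_eq_right hx, Real.zero_rpow (by linarith)])
  have hright : ∀ x ≥ 0,
      HasDerivWithinAt (fun x : ℝ => (max x 0) ^ q) (q * x ^ (q - 1)) (Ici 0) x :=
    fun x hx => (Real.hasDerivAt_rpow_const (Or.inr hq.le)).hasDerivWithinAt.congr
      (fun t ht => by rw [max_eq_left ht]) (by rw [max_eq_left hx])
  have hzero : q * (0 : ℝ) ^ (q - 1) = 0 := by rw [Real.zero_rpow (by linarith), mul_zero]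
  rcases lt_trichotomy x 0 with hx | rfl | hx
  · rw [max_eq_right hx.le, hzero]
    exact (hleft x hx.le).hasDerivAt (Iic_mem_nhds hx)
  · rw [max_self, ← hasDerivWithinAt_univ, ← Iic_union_Ici (a := (0 : ℝ))]
    rw [hzero]
    exact (hleft 0 le_rfl).union (by simpa only [hzero] using hright 0 le_rfl)
  · rw [max_eq_left hx.le]
    exact (hright x hx.le).hasDerivAt (Ici_mem_nhds hx)

lemma locallyLipschitz_max_zero_rpow {q : ℝ} (hq : 1 < q) :
    LocallyLipschitz fun x : ℝ => (max x 0) ^ q := by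
  refine ContDiff.locallyLipschitz (𝕂 := ℝ) (contDiff_one_iff_deriv.2
    ⟨fun x => (hasDerivAt_max_zero_rpow hq x).differentiableAt, ?_⟩)
  rw [funext fun x => (hasDerivAt_max_zero_rpow hq x).deriv]
  exact continuous_const.mul
    ((continuous_id.max continuous_const).rpow_const fun _ => Or.inr (by linarith))

lemma exists_inverse_of_strictAntiOn_Ici {f : ℝ → ℝ} {S l : ℝ} (hf : StrictAntiOn f (Ici S))
    (hcont : ContinuousOn f (Ici S)) (hlim : Tendsto f atTop (𝓝 l)) :
    ∃ g : ℝ → ℝ, (∀ a ∈ Ioo l (f S), S < g a ∧ f (g a) = a) ∧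
      ContinuousOn g (Ioo l (f S)) ∧ Tendsto g (𝓝[>] l) atTop := by
  have hsurj : ∀ a ∈ Ioo l (f S), ∃ t, S < t ∧ f t = a := fun a ha => by
    obtain ⟨t, hta, hSt⟩ := ((hlim.eventually_lt_const ha.1).and (eventually_ge_atTop S)).exists
    obtain ⟨s, hs, rfl⟩ :=
      intermediate_value_Icc' hSt (hcont.mono Icc_subset_Ici_self) ⟨hta.le, ha.2.le⟩
    exact ⟨s, hs.1.lt_of_ne (by rintro rfl; exact ha.2.false), rfl⟩
  choose! g hg using hsurj
  have hlt {t : ℝ} (ht : S ≤ t) : l < f t :=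
    (le_of_tendsto hlim ((eventually_ge_atTop (t + 1)).mono fun τ hτ =>
      hf.antitoneOn (mem_Ici.2 (by linarith)) (mem_Ici.2 (by linarith)) hτ)).trans_lt
      (hf ht (mem_Ici.2 (by linarith)) (lt_add_one t))
  have hleft {t : ℝ} (ht : S < t) : f t ∈ Ioo l (f S) ∧ g (f t) = t := by
    have hmem : f t ∈ Ioo l (f S) := ⟨hlt ht.le, hf self_mem_Ici ht.le ht⟩
    exact ⟨hmem, hf.injOn (hg _ hmem).1.le ht.le (hg _ hmem).2⟩
  have hanti : StrictAntiOn g (Ioo l (f S)) := fun a ha b hb hab => by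
    rwa [← hf.lt_iff_gt (hg a ha).1.le (hg b hb).1.le, (hg a ha).2, (hg b hb).2]
  refine ⟨g, hg, fun a ha => ?_, tendsto_atTop.2 fun N => ?_⟩
  · have himage : (fun a => -g a) '' Ioo l (f S) = Iio (-S) := by
      ext t
      refine ⟨?_, fun ht => ⟨f (-t), (hleft (lt_neg.1 ht)).1, ?_⟩⟩
      · rintro ⟨b, hb, rfl⟩
        exact neg_lt_neg (hg b hb).1
      · simp only [(hleft (lt_neg.1 ht)).2, neg_neg]
    have hneg := hanti.neg.continuousAt_of_image_mem_nhds (isOpen_Ioo.mem_nhds ha)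
      (himage ▸ Iio_mem_nhds (neg_lt_neg (hg a ha).1))
    exact (continuous_neg.continuousAt.comp hneg).continuousWithinAt.congr
      (fun b _ => (neg_neg (g b)).symm) (neg_neg (g a)).symm
  · set t := max N (S + 1)
    have ht : S < t := (lt_add_one S).trans_le (le_max_right _ _)
    filter_upwards [Ioo_mem_nhdsGT (hleft ht).1.1] with a ha
    have hgt := hanti ⟨ha.1, ha.2.trans (hleft ht).1.2⟩ (hleft ht).1 ha.2
    rw [(hleft ht).2] at hgt
    exact (le_max_left _ _).trans hgt.le

lemma mul_sub_lt_pi_of_riccati {q q' : ℝ → ℝ} {a b ω : ℝ} (hab : a ≤ b)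
    (hq : ∀ t ∈ Icc a b, HasDerivWithinAt q (q' t) (Icc a b) t)
    (hq' : ∀ t ∈ Icc a b, q' t ≤ -(ω * (1 + q t ^ 2))) : ω * (b - a) < Real.pi := by
  have hanti : AntitoneOn (fun t => Real.arctan (q t) + ω * t) (Icc a b) :=
    antitoneOn_of_forall_hasDerivWithinAt (convex_Icc a b)
      (fun t ht => (hq t ht).arctan.add (((hasDerivWithinAt_id t _).const_mul ω)))
      fun t ht => by
        have hpos : 0 < 1 + q t ^ 2 := by positivity
        have hle : 1 / (1 + q t ^ 2) * q' t ≤ -ω := by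
          rw [one_div_mul_eq_div, div_le_iff₀ hpos]
          linarith [hq' t ht]
        linarith
  have hle := hanti (left_mem_Icc.2 hab) (right_mem_Icc.2 hab) hab
  simp only at hle
  linarith [Real.neg_pi_div_two_lt_arctan (q b), Real.arctan_lt_pi_div_two (q a)]

lemma nonneg_of_deriv_le_mul {g g' : ℝ → ℝ} {S m : ℝ} (hm : 0 < m)
    (hg : ∀ t ∈ Ici S, HasDerivWithinAt g (g' t) (Ici S) t) (hle : ∀ t ∈ Ici S, g' t ≤ m * g t)
    (hlim : Tendsto g atTop (𝓝 0)) {t : ℝ} (ht : S ≤ t) : 0 ≤ g t := by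
  have hanti : AntitoneOn (fun t => Real.exp (-m * t) * g t) (Ici S) :=
    antitoneOn_of_forall_hasDerivWithinAt (convex_Ici S)
      (fun t ht => ((hasDerivAt_id t).const_mul (-m)).exp.hasDerivWithinAt.mul (hg t ht))
      fun t ht => by
        have hprod := mul_le_mul_of_nonneg_left (hle t ht) (Real.exp_pos (-m * t)).le
        simp only [id]
        linarith
  have hexp : Tendsto (fun t => Real.exp (-m * t)) atTop (𝓝 0) :=
    Real.tendsto_exp_atBot.comp (tendsto_id.const_mul_atTop_of_neg (neg_neg_of_pos hm))
  have hprod : 0 ≤ Real.exp (-m * t) * g t := by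
    refine le_of_tendsto (by simpa only [zero_mul] using hexp.mul hlim) ?_
    filter_upwards [eventually_ge_atTop t] with s hs
    exact hanti ht (mem_Ici.2 (ht.trans hs)) hs
  exact nonneg_of_mul_nonneg_right hprod (Real.exp_pos _)

lemma hasDerivWithinAt_Ici_of_eventually_hasDerivAt {v g : ℝ → ℝ} {a : ℝ}
    (hv : ContinuousWithinAt v (Ici a) a) (hg : ContinuousWithinAt g (Ici a) a)
    (hderiv : ∀ᶠ r in 𝓝[>] a, HasDerivAt v (g r) r) : HasDerivWithinAt v (g a) (Ici a) a := by
  obtain ⟨s, hs, hderiv⟩ := eventually_iff_exists_mem.1 hderiv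
  refine hasDerivWithinAt_Ici_of_tendsto_deriv (s := s ∩ Ioi a)
    (fun r hr => (hderiv r hr.1).differentiableAt.differentiableWithinAt)
    (hv.mono fun r hr => (mem_Ioi.1 hr.2).le) (inter_mem hs self_mem_nhdsWithin)
    ((hg.tendsto.mono_left (nhdsWithin_mono a Ioi_subset_Ici_self)).congr' ?_)
  filter_upwards [hs] with r hr
  exact (hderiv r hr).deriv.symm

end RealFunctions

/-! ### Autonomous differential equations -/

section Autonomous

variable {E : Type*} [NormedAddCommGroup E] [NormedSpace ℝ E] {v : E → E}

lemma eqOn_Icc_of_isIntegralCurveOn (hv : LocallyLipschitz v) {γ₁ γ₂ : ℝ → E} {a b : ℝ}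
    (h₁ : IsIntegralCurveOn γ₁ (fun _ => v) (Icc a b))
    (h₂ : IsIntegralCurveOn γ₂ (fun _ => v) (Icc a b)) (hend : γ₁ a = γ₂ a ∨ γ₁ b = γ₂ b) :
    EqOn γ₁ γ₂ (Icc a b) := by
  obtain ⟨K, hK⟩ := hv.locallyLipschitzOn.exists_lipschitzOnWith_of_compact
    ((isCompact_Icc.image_of_continuousOn h₁.continuousOn).union
      (isCompact_Icc.image_of_continuousOn h₂.continuousOn))
  have hmem₁ : ∀ t ∈ Icc a b, γ₁ t ∈ γ₁ '' Icc a b ∪ γ₂ '' Icc a b :=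
    fun t ht => Or.inl (mem_image_of_mem _ ht)
  have hmem₂ : ∀ t ∈ Icc a b, γ₂ t ∈ γ₁ '' Icc a b ∪ γ₂ '' Icc a b :=
    fun t ht => Or.inr (mem_image_of_mem _ ht)
  rcases hend with ha | hb
  · have hIco : Ico a b ⊆ Icc a b := Ico_subset_Icc_self
    have hd : ∀ {γ : ℝ → E}, IsIntegralCurveOn γ (fun _ => v) (Icc a b) →
        ∀ t ∈ Ico a b, HasDerivWithinAt γ (v (γ t)) (Ici t) t := fun h t ht =>
      (h t (hIco ht)).mono_of_mem_nhdsWithin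
        (mem_of_superset (Icc_mem_nhdsGE ht.2) (Icc_subset_Icc_left ht.1))
    exact ODE_solution_unique_of_mem_Icc_right (fun _ _ => hK) h₁.continuousOn (hd h₁)
      (fun t ht => hmem₁ t (hIco ht)) h₂.continuousOn (hd h₂) (fun t ht => hmem₂ t (hIco ht)) ha
  · have hIoc : Ioc a b ⊆ Icc a b := Ioc_subset_Icc_self
    have hd : ∀ {γ : ℝ → E}, IsIntegralCurveOn γ (fun _ => v) (Icc a b) →
        ∀ t ∈ Ioc a b, HasDerivWithinAt γ (v (γ t)) (Iic t) t := fun h t ht =>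
      (h t (hIoc ht)).mono_of_mem_nhdsWithin
        (mem_of_superset (Icc_mem_nhdsLE ht.1) (Icc_subset_Icc_right ht.2))
    exact ODE_solution_unique_of_mem_Icc_left (fun _ _ => hK) h₁.continuousOn (hd h₁)
      (fun t ht => hmem₁ t (hIoc ht)) h₂.continuousOn (hd h₂) (fun t ht => hmem₂ t (hIoc ht)) hb

lemma eqOn_of_isIntegralCurveOn (hv : LocallyLipschitz v) {γ₁ γ₂ : ℝ → E} {I : Set ℝ}
    (hI : I.OrdConnected) (h₁ : IsIntegralCurveOn γ₁ (fun _ => v) I)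
    (h₂ : IsIntegralCurveOn γ₂ (fun _ => v) I) {t₀ : ℝ} (ht₀ : t₀ ∈ I) (heq : γ₁ t₀ = γ₂ t₀) :
    EqOn γ₁ γ₂ I := by
  intro t ht
  rcases le_total t₀ t with hle | hle
  · have hsub := hI.out ht₀ ht
    exact eqOn_Icc_of_isIntegralCurveOn hv (h₁.mono hsub) (h₂.mono hsub) (Or.inl heq)
      (right_mem_Icc.2 hle)
  · have hsub := hI.out ht ht₀
    exact eqOn_Icc_of_isIntegralCurveOn hv (h₁.mono hsub) (h₂.mono hsub) (Or.inr heq)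
      (left_mem_Icc.2 hle)

lemma exists_isIntegralCurveOn_Icc_of_bounded [CompleteSpace E] {K L : NNReal}
    (hK : LipschitzWith K v) (hL : ∀ z, ‖v z‖ ≤ L) (z₀ : E) {T : ℝ} (hT : 0 ≤ T) :
    ∃ γ : ℝ → E, γ 0 = z₀ ∧ IsIntegralCurveOn γ (fun _ => v) (Icc 0 T) := by
  have hpl : IsPicardLindelof (fun _ : ℝ => v) (tmin := 0) (tmax := T) ⟨0, le_rfl, hT⟩ z₀
      (L * T.toNNReal) 0 L K :=
    IsPicardLindelof.of_time_independent (fun z _ => hL z) hK.lipschitzOnWith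
      (by simp [Real.coe_toNNReal T hT, hT])
  exact hpl.exists_eq_forall_mem_Icc_hasDerivWithinAt₀

lemma exists_isIntegralCurveOn_Ici (hv : LocallyLipschitz v) {z₀ : E}
    (h : ∀ T, 0 ≤ T → ∃ γ : ℝ → E, γ 0 = z₀ ∧ IsIntegralCurveOn γ (fun _ => v) (Icc 0 T)) :
    ∃ γ : ℝ → E, γ 0 = z₀ ∧ IsIntegralCurveOn γ (fun _ => v) (Ici 0) := by
  have hstep (n : ℕ) : (0 : ℝ) ≤ n + 1 := by positivity
  choose! γ hγ0 hγ using fun n : ℕ => h (n + 1) (hstep n)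
  have hagree {i j : ℕ} (hij : i ≤ j) : EqOn (γ i) (γ j) (Icc 0 (i + 1)) := by
    have hij' : (i : ℝ) + 1 ≤ j + 1 := by gcongr
    exact eqOn_of_isIntegralCurveOn hv ordConnected_Icc (hγ i)
      ((hγ j).mono (Icc_subset_Icc_right hij')) (left_mem_Icc.2 (hstep i)) (by rw [hγ0, hγ0])
  have hlt (t : ℝ) : t < ⌈t⌉₊ + 1 := (Nat.le_ceil t).trans_lt (lt_add_one _)
  refine ⟨fun t => γ ⌈t⌉₊ t, hγ0 _, fun t ht => ?_⟩
  have hnear : Icc 0 ((⌈t⌉₊ : ℝ) + 1) ∈ 𝓝[Ici 0] t :=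
    inter_mem_nhdsWithin _ (Iic_mem_nhds (hlt t))
  have hcurve : HasDerivWithinAt (γ ⌈t⌉₊) (v (γ ⌈t⌉₊ t)) (Ici 0) t :=
    (hγ _ t ⟨ht, (hlt t).le⟩).mono_of_mem_nhdsWithin hnear
  refine hcurve.congr_of_eventuallyEq ?_ rfl
  filter_upwards [hnear] with s hs
  rcases le_total ⌈s⌉₊ ⌈t⌉₊ with hle | hle
  · exact hagree hle ⟨hs.1, (hlt s).le⟩
  · exact (hagree hle hs).symm

lemma exists_lipschitzWith_retraction_closedBall {R : ℝ} (hR : 0 ≤ R) :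
    ∃ r : ℝ × ℝ → ℝ × ℝ, LipschitzWith 1 r ∧ (∀ z, ‖r z‖ ≤ R) ∧ ∀ z, ‖z‖ ≤ R → r z = z := by
  have hRR : -R ≤ R := by linarith
  set clip : ℝ → ℝ := fun x => projIcc (-R) R hRR x
  have hlip : LipschitzWith 1 clip :=
    (LipschitzWith.subtype_val _).comp (LipschitzWith.projIcc hRR) |>.weaken (by simp)
  refine ⟨fun z => (clip z.1, clip z.2), ?_, fun z => ?_, fun z hz => ?_⟩
  · simpa using (hlip.comp LipschitzWith.prod_fst).prodMk (hlip.comp LipschitzWith.prod_snd)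
  · exact norm_prod_le_iff.2 ⟨abs_le.2 (projIcc _ _ hRR z.1).2, abs_le.2 (projIcc _ _ hRR z.2).2⟩
  · obtain ⟨h₁, h₂⟩ := norm_prod_le_iff.1 hz
    exact Prod.ext (congrArg Subtype.val (projIcc_of_mem hRR (abs_le.1 h₁)))
      (congrArg Subtype.val (projIcc_of_mem hRR (abs_le.1 h₂)))

/-- The field is composed with a Lipschitz retraction onto a ball, which makes it bounded and
globally Lipschitz; the a priori bound keeps the solution inside that ball. -/
lemma exists_isIntegralCurveOn_Icc_of_apriori_bound {v : ℝ × ℝ → ℝ × ℝ} (hv : LocallyLipschitz v)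
    {z₀ : ℝ × ℝ} {R T : ℝ} (hT : 0 ≤ T) (hR : ∀ γ : ℝ → ℝ × ℝ, ∀ t ∈ Icc 0 T, γ 0 = z₀ →
      IsIntegralCurveOn γ (fun _ => v) (Icc 0 t) → ‖γ t‖ ≤ R) :
    ∃ γ : ℝ → ℝ × ℝ, γ 0 = z₀ ∧ IsIntegralCurveOn γ (fun _ => v) (Icc 0 T) := by
  set R' := max R ‖z₀‖ + 1 with hR'
  have hR'pos : 0 ≤ R' := by positivity
  obtain ⟨r, hr, hrR, hrid⟩ := exists_lipschitzWith_retraction_closedBall hR'pos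
  have hball := isCompact_closedBall (0 : ℝ × ℝ) R'
  have hmaps : MapsTo r univ (Metric.closedBall 0 R') := fun z _ =>
    mem_closedBall_zero_iff.2 (hrR z)
  obtain ⟨K, hK⟩ := hv.locallyLipschitzOn.exists_lipschitzOnWith_of_compact hball
  obtain ⟨L, hL⟩ := hball.exists_bound_of_continuousOn hv.continuous.continuousOn
  obtain ⟨γ, hγ0, hγ⟩ := exists_isIntegralCurveOn_Icc_of_bounded (L := L.toNNReal)
    (lipschitzOnWith_univ.1 (hK.comp hr.lipschitzOnWith hmaps))
    (fun z => (hL _ (hmaps (mem_univ z))).trans (Real.le_coe_toNNReal L)) z₀ hT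
  have hunclip {s : ℝ} (hsT : s ≤ T) (hs : ∀ t ∈ Icc 0 s, ‖γ t‖ ≤ R') :
      IsIntegralCurveOn γ (fun _ => v) (Icc 0 s) := fun t ht => by
    simpa only [Function.comp_apply, hrid _ (hs t ht)] using
      hγ.mono (Icc_subset_Icc_right hsT) t ht
  suffices hinside : ∀ t ∈ Icc 0 T, ‖γ t‖ < R' from
    ⟨γ, hγ0, hunclip le_rfl fun t ht => (hinside t ht).le⟩
  intro t ht
  by_contra! hexit
  obtain ⟨s, hs, hs0, hbefore⟩ := exists_first_zero (f := fun t => R' - ‖γ t‖)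
    (continuousOn_const.sub (hγ.mono (Icc_subset_Icc_right ht.2)).continuousOn.norm) ht.1
    (by simp only [hγ0, hR']; linarith [le_max_right R ‖z₀‖]) (by linarith)
  have hsT := hs.2.trans ht.2
  have hcurve := hunclip hsT fun τ hτ => by
    rcases hτ.2.eq_or_lt with rfl | hlt
    · linarith
    · linarith [hbefore τ ⟨hτ.1, hlt⟩]
  linarith [hR γ s ⟨hs.1.le, hsT⟩ hγ0 hcurve, le_max_left R ‖z₀‖]

lemma tendsto_of_isIntegralCurveOn [ProperSpace E] (hv : LocallyLipschitz v) {ι : Type*}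
    {l : Filter ι} {γ : ι → ℝ → E} {γ₀ : ℝ → E} {T R : ℝ} (hT : 0 ≤ T)
    (hγ : ∀ᶠ i in l, IsIntegralCurveOn (γ i) (fun _ => v) (Icc 0 T) ∧ ∀ t ∈ Icc 0 T, ‖γ i t‖ ≤ R)
    (hγ₀ : IsIntegralCurveOn γ₀ (fun _ => v) (Icc 0 T)) (hR : ∀ t ∈ Icc 0 T, ‖γ₀ t‖ ≤ R)
    (hinitial : Tendsto (fun i => γ i 0) l (𝓝 (γ₀ 0))) :
    Tendsto (fun i => γ i T) l (𝓝 (γ₀ T)) := by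
  obtain ⟨K, hK⟩ := hv.locallyLipschitzOn.exists_lipschitzOnWith_of_compact
    (isCompact_closedBall (0 : E) R)
  have hright {γ : ℝ → E} (h : IsIntegralCurveOn γ (fun _ => v) (Icc 0 T)) :
      ∀ t ∈ Ico 0 T, HasDerivWithinAt γ (v (γ t)) (Ici t) t := fun t ht =>
    (h t (Ico_subset_Icc_self ht)).mono_of_mem_nhdsWithin
      (mem_of_superset (Icc_mem_nhdsGE ht.2) (Icc_subset_Icc_left ht.1))
  have hball {γ : ℝ → E} (h : ∀ t ∈ Icc 0 T, ‖γ t‖ ≤ R) :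
      ∀ t ∈ Ico 0 T, γ t ∈ Metric.closedBall 0 R := fun t ht =>
    mem_closedBall_zero_iff.2 (h t (Ico_subset_Icc_self ht))
  have hgronwall : ∀ᶠ i in l,
      dist (γ i T) (γ₀ T) ≤ dist (γ i 0) (γ₀ 0) * Real.exp (K * (T - 0)) := by
    filter_upwards [hγ] with i hi
    exact dist_le_of_trajectories_ODE_of_mem (fun _ _ => hK) hi.1.continuousOn (hright hi.1)
      (hball hi.2) hγ₀.continuousOn (hright hγ₀) (hball hR) le_rfl T (right_mem_Icc.2 hT)
  refine tendsto_iff_dist_tendsto_zero.2 (squeeze_zero' (Eventually.of_forall fun _ => dist_nonneg)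
    hgronwall ?_)
  simpa using (tendsto_iff_dist_tendsto_zero.1 hinitial).mul_const (Real.exp (K * (T - 0)))

lemma uniformContinuousOn_comp_of_isIntegralCurveOn (hv : Continuous v) {γ : ℝ → E} {I : Set ℝ}
    (hI : Convex ℝ I) (hγ : IsIntegralCurveOn γ (fun _ => v) I) {C : Set E} (hC : IsCompact C)
    (hmaps : MapsTo γ I C) {G : E → ℝ} (hG : Continuous G) : UniformContinuousOn (G ∘ γ) I := by
  obtain ⟨L, hL⟩ := hC.exists_bound_of_continuousOn hv.continuousOn
  have hlip : LipschitzOnWith L.toNNReal γ I :=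
    hI.lipschitzOnWith_of_nnnorm_hasDerivWithin_le hγ fun t ht => by
      rw [← NNReal.coe_le_coe, coe_nnnorm]
      exact (hL _ (hmaps ht)).trans (Real.le_coe_toNNReal L)
  exact (hC.uniformContinuousOn_of_continuous hG.continuousOn).comp hlip.uniformContinuousOn hmaps

end Autonomous

/-! ### The damped oscillator -/

/-- `(x, y)` solves `x' = y`, `y' = -d y - f(x)` on `I`, with derivatives taken within `I`: a
solution of the damped oscillator equation `x'' + d x' + f(x) = 0`, seen in the phase plane. -/
structure IsPhaseCurveOn (d : ℝ) (f x y : ℝ → ℝ) (I : Set ℝ) : Prop where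
  deriv_x : ∀ t ∈ I, HasDerivWithinAt x (y t) I t
  deriv_y : ∀ t ∈ I, HasDerivWithinAt y (-d * y t - f (x t)) I t

/-- The vector field whose integral curves are the phase curves. -/
def oscillatorField (d : ℝ) (f : ℝ → ℝ) (z : ℝ × ℝ) : ℝ × ℝ := (z.2, -d * z.2 - f z.1)

/-- The mechanical energy at position `x` and velocity `y` in the potential `V`. -/
noncomputable def energy (V : ℝ → ℝ) (x y : ℝ) : ℝ := y ^ 2 / 2 + V x

section PhaseCurve

variable {d e α : ℝ} {f V x y : ℝ → ℝ} {I J : Set ℝ}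

lemma locallyLipschitz_oscillatorField (hf : LocallyLipschitz f) :
    LocallyLipschitz (oscillatorField d f) := by
  have hx : LocallyLipschitz fun z : ℝ × ℝ => f z.1 :=
    hf.comp LipschitzWith.prod_fst.locallyLipschitz
  have hy : LocallyLipschitz fun z : ℝ × ℝ => -d * z.2 :=
    ((lipschitzWith_smul (-d)).comp LipschitzWith.prod_snd).locallyLipschitz
  exact LipschitzWith.prod_snd.locallyLipschitz.prodMk (hy.sub hx)

lemma isPhaseCurveOn_iff_isIntegralCurveOn :
    IsPhaseCurveOn d f x y I ↔
      IsIntegralCurveOn (fun t => (x t, y t)) (fun _ => oscillatorField d f) I :=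
  ⟨fun h t ht => (h.deriv_x t ht).prodMk (h.deriv_y t ht), fun h =>
    ⟨fun t ht => (h t ht).hasFDerivWithinAt.fst.hasDerivWithinAt.congr_deriv
        (by simp [oscillatorField]),
      fun t ht => (h t ht).hasFDerivWithinAt.snd.hasDerivWithinAt.congr_deriv
        (by simp [oscillatorField])⟩⟩

namespace IsPhaseCurveOn

lemma mono (h : IsPhaseCurveOn d f x y I) (hJ : J ⊆ I) : IsPhaseCurveOn d f x y J :=
  ⟨fun t ht => (h.deriv_x t (hJ ht)).mono hJ, fun t ht => (h.deriv_y t (hJ ht)).mono hJ⟩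

lemma continuousOn_x (h : IsPhaseCurveOn d f x y I) : ContinuousOn x I :=
  fun t ht => (h.deriv_x t ht).continuousWithinAt

lemma continuousOn_y (h : IsPhaseCurveOn d f x y I) : ContinuousOn y I :=
  fun t ht => (h.deriv_y t ht).continuousWithinAt

lemma eqOn (hf : LocallyLipschitz f) (hI : I.OrdConnected) (h : IsPhaseCurveOn d f x y I)
    {x' y' : ℝ → ℝ} (h' : IsPhaseCurveOn d f x' y' I) {t₀ : ℝ} (ht₀ : t₀ ∈ I)
    (hx : x t₀ = x' t₀) (hy : y t₀ = y' t₀) {t : ℝ} (ht : t ∈ I) : x t = x' t ∧ y t = y' t :=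
  Prod.ext_iff.1 (eqOn_of_isIntegralCurveOn (locallyLipschitz_oscillatorField hf) hI
    (isPhaseCurveOn_iff_isIntegralCurveOn.1 h) (isPhaseCurveOn_iff_isIntegralCurveOn.1 h') ht₀
    (Prod.ext hx hy) ht)

lemma hasDerivWithinAt_energy (hV : ∀ x, HasDerivAt V (f x) x) (h : IsPhaseCurveOn d f x y I)
    {t : ℝ} (ht : t ∈ I) :
    HasDerivWithinAt (fun t => energy V (x t) (y t)) (-d * y t ^ 2) I t := by
  refine ((((h.deriv_y t ht).pow 2).div_const 2).add
    ((hV (x t)).comp_hasDerivWithinAt t (h.deriv_x t ht))).congr_deriv ?_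
  ring

lemma antitoneOn_energy (hV : ∀ x, HasDerivAt V (f x) x) (hd : 0 ≤ d) (hI : Convex ℝ I)
    (h : IsPhaseCurveOn d f x y I) : AntitoneOn (fun t => energy V (x t) (y t)) I :=
  antitoneOn_of_forall_hasDerivWithinAt hI (fun _ ht => h.hasDerivWithinAt_energy hV ht)
    fun t _ => mul_nonpos_of_nonpos_of_nonneg (neg_nonpos.2 hd) (sq_nonneg (y t))

lemma norm_le (hV : ∀ x, HasDerivAt V (f x) x) (hd : 0 ≤ d) {B E T : ℝ} (hB : ∀ x, -B ≤ V x)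
    (h : IsPhaseCurveOn d f x y (Icc 0 T)) (hx : x 0 = 0) (hE : energy V (x 0) (y 0) ≤ E) {t : ℝ}
    (ht : t ∈ Icc 0 T) : ‖(x t, y t)‖ ≤ √(2 * (E + B)) * (T + 1) := by
  have hT : 0 ≤ T := ht.1.trans ht.2
  have hspeed : ∀ s ∈ Icc 0 T, |y s| ≤ √(2 * (E + B)) := fun s hs => by
    have henergy := h.antitoneOn_energy hV hd (convex_Icc 0 T) (left_mem_Icc.2 hT) hs hs.1
    simp only [energy] at henergy hE
    exact Real.abs_le_sqrt (by linarith [hB (x s)])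
  have hdist : |x t| ≤ √(2 * (E + B)) * T := by
    have hmean := (convex_Icc 0 T).norm_image_sub_le_of_norm_hasDerivWithin_le h.deriv_x hspeed
      (left_mem_Icc.2 hT) ht
    rw [hx, sub_zero, sub_zero, Real.norm_eq_abs, Real.norm_eq_abs, abs_of_nonneg ht.1] at hmean
    exact hmean.trans (by gcongr; exact ht.2)
  have hsqrt := Real.sqrt_nonneg (2 * (E + B))
  refine norm_prod_le_iff.2 ⟨hdist.trans ?_, (hspeed t ht).trans ?_⟩
  · gcongr
    linarith
  · exact le_mul_of_one_le_right hsqrt (by linarith)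

end IsPhaseCurveOn

/-- The phase curve on `[0, ∞)` that starts at `(0, α)`. -/
structure IsTrajectory (d : ℝ) (f : ℝ → ℝ) (α : ℝ) (x y : ℝ → ℝ) : Prop where
  x_zero : x 0 = 0
  y_zero : y 0 = α
  phaseCurve : IsPhaseCurveOn d f x y (Ici 0)

/-- A force field which vanishes on the negative half-line and whose potential, normalized by
`V 0 = 0`, confines on the positive half-line. -/
structure IsOneSidedWell (f V : ℝ → ℝ) : Prop where
  locallyLipschitz : LocallyLipschitz f
  hasDerivAt : ∀ x, HasDerivAt V (f x) x
  force_of_nonpos : ∀ x ≤ 0, f x = 0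
  potential_zero : V 0 = 0
  tendsto_atTop : Tendsto V atTop atTop

namespace IsOneSidedWell

lemma continuous_potential (hW : IsOneSidedWell f V) : Continuous V :=
  continuous_iff_continuousAt.2 fun x => (hW.hasDerivAt x).continuousAt

lemma potential_of_nonpos (hW : IsOneSidedWell f V) {x : ℝ} (hx : x ≤ 0) : V x = 0 := by
  have hconst := (convex_Iic (0 : ℝ)).norm_image_sub_le_of_norm_hasDerivWithin_le (C := 0)
    (fun t _ => (hW.hasDerivAt t).hasDerivWithinAt)
    (fun t ht => by rw [hW.force_of_nonpos t ht, norm_zero]) self_mem_Iic hx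
  simpa [hW.potential_zero] using hconst

lemma exists_neg_le_potential (hW : IsOneSidedWell f V) : ∃ B, ∀ x, -B ≤ V x := by
  obtain ⟨M, hM⟩ := eventually_atTop.1 (hW.tendsto_atTop.eventually_ge_atTop 0)
  obtain ⟨C, hC⟩ := (isCompact_Icc (a := 0) (b := M)).exists_bound_of_continuousOn
    hW.continuous_potential.continuousOn
  refine ⟨max C 0, fun x => ?_⟩
  rcases le_total x 0 with hx | hx
  · simp [hW.potential_of_nonpos hx]
  rcases le_total x M with hxM | hxM
  · linarith [(abs_le.1 (hC x ⟨hx, hxM⟩)).1, le_max_left C 0]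
  · linarith [hM x hxM, le_max_right C 0]

end IsOneSidedWell

namespace IsTrajectory

variable {t : ℝ} {x' y' : ℝ → ℝ}

lemma hasDerivWithinAt_x (h : IsTrajectory d f α x y) (ht : 0 ≤ t) :
    HasDerivWithinAt x (y t) (Ici 0) t := h.phaseCurve.deriv_x t ht

lemma eq (hf : LocallyLipschitz f) (h : IsTrajectory d f α x y) (h' : IsTrajectory d f α x' y')
    (ht : 0 ≤ t) : x t = x' t ∧ y t = y' t :=
  h.phaseCurve.eqOn hf ordConnected_Ici h'.phaseCurve self_mem_Ici (h.x_zero.trans h'.x_zero.symm)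
    (h.y_zero.trans h'.y_zero.symm) ht

lemma energy_le (hW : IsOneSidedWell f V) (hd : 0 ≤ d) (h : IsTrajectory d f α x y) (ht : 0 ≤ t) :
    energy V (x t) (y t) ≤ α ^ 2 / 2 := by
  simpa [energy, h.x_zero, h.y_zero, hW.potential_zero] using
    h.phaseCurve.antitoneOn_energy hW.hasDerivAt hd (convex_Ici 0) self_mem_Ici ht ht

end IsTrajectory

lemma exists_isTrajectory (hW : IsOneSidedWell f V) (hd : 0 ≤ d) (α : ℝ) :
    ∃ x y : ℝ → ℝ, IsTrajectory d f α x y := by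
  have hv := locallyLipschitz_oscillatorField (d := d) hW.locallyLipschitz
  obtain ⟨B, hB⟩ := hW.exists_neg_le_potential
  obtain ⟨γ, hγ0, hγ⟩ := exists_isIntegralCurveOn_Ici hv (z₀ := (0, α)) fun T hT =>
    exists_isIntegralCurveOn_Icc_of_apriori_bound hv hT
      (R := √(2 * (energy V 0 α + B)) * (T + 1)) fun γ t ht h0 hcurve => by
        have hphase := (isPhaseCurveOn_iff_isIntegralCurveOn (x := fun t => (γ t).1)).2 hcurve
        refine (hphase.norm_le hW.hasDerivAt hd hB (by simp [h0]) (E := energy V 0 α) (by simp [h0])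
          (right_mem_Icc.2 ht.1)).trans ?_
        gcongr
        exact ht.2
  exact ⟨fun t => (γ t).1, fun t => (γ t).2, by simp [hγ0], by simp [hγ0],
    isPhaseCurveOn_iff_isIntegralCurveOn.2 hγ⟩

lemma continuous_trajectory (hW : IsOneSidedWell f V) (hd : 0 ≤ d) {X Y : ℝ → ℝ → ℝ}
    (h : ∀ α, IsTrajectory d f α (X α) (Y α)) {T : ℝ} (hT : 0 ≤ T) :
    Continuous fun α => (X α T, Y α T) := by
  refine continuous_iff_continuousAt.2 fun α => ?_
  obtain ⟨B, hB⟩ := hW.exists_neg_le_potential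
  have hcurve (β : ℝ) := (h β).phaseCurve.mono (J := Icc 0 T) Icc_subset_Ici_self
  have hbound {β : ℝ} (hβ : |β| ≤ |α| + 1) :
      ∀ t ∈ Icc 0 T, ‖(X β t, Y β t)‖ ≤ √(2 * ((|α| + 1) ^ 2 / 2 + B)) * (T + 1) :=
    fun t ht => (hcurve β).norm_le hW.hasDerivAt hd hB (h β).x_zero
      (((h β).energy_le hW hd le_rfl).trans
        (by gcongr ?_ / 2; exact sq_le_sq' (abs_le.1 hβ).1 (abs_le.1 hβ).2)) ht
  have hnear : ∀ᶠ β in 𝓝 α, |β| ≤ |α| + 1 :=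
    (continuous_abs.tendsto α).eventually_le_const (lt_add_one _)
  refine tendsto_of_isIntegralCurveOn (γ := fun β t => (X β t, Y β t))
    (locallyLipschitz_oscillatorField hW.locallyLipschitz) hT ?_
    (isPhaseCurveOn_iff_isIntegralCurveOn.1 (hcurve α)) (hbound (by linarith)) ?_
  · filter_upwards [hnear] with β hβ
    exact ⟨isPhaseCurveOn_iff_isIntegralCurveOn.1 (hcurve β), hbound hβ⟩
  · simp only [(h _).x_zero, (h _).y_zero]
    exact tendsto_const_nhds.prodMk_nhds tendsto_id

/-- The initial slopes of the trajectories that visit the region `O` of the phase plane. -/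
def slopesReaching (d : ℝ) (f : ℝ → ℝ) (O : Set (ℝ × ℝ)) : Set ℝ :=
  {α | ∃ x y : ℝ → ℝ, IsTrajectory d f α x y ∧ ∃ t, 0 ≤ t ∧ (x t, y t) ∈ O}

lemma IsTrajectory.mem_slopesReaching_iff (hf : LocallyLipschitz f) {α : ℝ} {O : Set (ℝ × ℝ)}
    (h : IsTrajectory d f α x y) :
    α ∈ slopesReaching d f O ↔ ∃ t, 0 ≤ t ∧ (x t, y t) ∈ O := by
  refine ⟨fun ⟨x', y', h', t, ht, hmem⟩ => ⟨t, ht, ?_⟩, fun hO => ⟨x, y, h, hO⟩⟩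
  obtain ⟨hx, hy⟩ := h.eq hf h' ht
  rwa [hx, hy]

lemma isOpen_slopesReaching (hW : IsOneSidedWell f V) (hd : 0 ≤ d) {O : Set (ℝ × ℝ)}
    (hO : IsOpen O) : IsOpen (slopesReaching d f O) := by
  choose X Y h using exists_isTrajectory (d := d) hW hd
  have hunion : slopesReaching d f O = ⋃ t ∈ Ici (0 : ℝ), {α | (X α t, Y α t) ∈ O} := by
    ext α
    simp [(h α).mem_slopesReaching_iff hW.locallyLipschitz]
  rw [hunion]
  exact isOpen_biUnion fun t ht => hO.preimage (continuous_trajectory hW hd h ht)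

namespace IsPhaseCurveOn

variable {T : ℝ} {C : Set (ℝ × ℝ)}

lemma uniformContinuousOn_comp (hf : LocallyLipschitz f) (hI : Convex ℝ I)
    (h : IsPhaseCurveOn d f x y I) (hC : IsCompact C) (hmaps : ∀ t ∈ I, (x t, y t) ∈ C)
    {G : ℝ × ℝ → ℝ} (hG : Continuous G) : UniformContinuousOn (fun t => G (x t, y t)) I :=
  uniformContinuousOn_comp_of_isIntegralCurveOn (locallyLipschitz_oscillatorField hf).continuous hI
    (isPhaseCurveOn_iff_isIntegralCurveOn.1 h) hC hmaps hG

lemma exists_tendsto_energy (hV : ∀ x, HasDerivAt V (f x) x) (hd : 0 ≤ d)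
    (h : IsPhaseCurveOn d f x y (Ici T)) (hC : IsCompact C) (hmaps : ∀ t ∈ Ici T, (x t, y t) ∈ C) :
    ∃ L, Tendsto (fun t => energy V (x t) (y t)) atTop (𝓝 L) ∧
      ∀ t, T ≤ t → L ≤ energy V (x t) (y t) := by
  have hVcont : Continuous V := continuous_iff_continuousAt.2 fun x => (hV x).continuousAt
  have hcont : Continuous fun z : ℝ × ℝ => energy V z.1 z.2 := by
    unfold energy
    fun_prop
  obtain ⟨B, hB⟩ := hC.bddBelow_image hcont.continuousOn
  exact exists_tendsto_of_antitoneOn_Ici (h.antitoneOn_energy hV hd (convex_Ici T))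
    fun t ht => hB (mem_image_of_mem _ (hmaps t ht))

lemma tendsto_y_zero (hf : LocallyLipschitz f) (hV : ∀ x, HasDerivAt V (f x) x) (hd : 0 < d)
    (h : IsPhaseCurveOn d f x y (Ici T)) (hC : IsCompact C) (hmaps : ∀ t ∈ Ici T, (x t, y t) ∈ C) :
    Tendsto y atTop (𝓝 0) := by
  obtain ⟨L, hL, -⟩ := h.exists_tendsto_energy hV hd.le hC hmaps
  have hdissipation : Tendsto (fun t => -d * y t ^ 2) atTop (𝓝 0) :=
    tendsto_zero_of_uniformContinuousOn_deriv hL (fun t ht => h.hasDerivWithinAt_energy hV ht)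
      (h.uniformContinuousOn_comp hf (convex_Ici T) hC hmaps (G := fun z => -d * z.2 ^ 2)
        (by fun_prop))
  have habs : Tendsto (fun t => √((-d)⁻¹ * (-d * y t ^ 2))) atTop (𝓝 0) := by
    simpa using (hdissipation.const_mul (-d)⁻¹).sqrt
  refine (tendsto_zero_iff_abs_tendsto_zero y).2 (habs.congr fun t => ?_)
  rw [inv_mul_cancel_left₀ (neg_ne_zero.2 hd.ne'), Real.sqrt_sq_eq_abs, Function.comp_apply]

lemma tendsto_force_zero (hf : LocallyLipschitz f) (hV : ∀ x, HasDerivAt V (f x) x) (hd : 0 < d)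
    (h : IsPhaseCurveOn d f x y (Ici T)) (hC : IsCompact C) (hmaps : ∀ t ∈ Ici T, (x t, y t) ∈ C) :
    Tendsto (fun t => f (x t)) atTop (𝓝 0) := by
  have hy := h.tendsto_y_zero hf hV hd hC hmaps
  have hfcont := hf.continuous
  have hacc : Tendsto (fun t => -d * y t - f (x t)) atTop (𝓝 0) :=
    tendsto_zero_of_uniformContinuousOn_deriv hy h.deriv_y
      (h.uniformContinuousOn_comp hf (convex_Ici T) hC hmaps (G := fun z => -d * z.2 - f z.1)
        (by fun_prop))
  simpa using (hy.const_mul (-d)).sub hacc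

/-- In the half-plane `x ≤ 0`, where the force vanishes, `y` is a multiple of `exp (-d t)`. -/
lemma neg_of_zero (hf : ∀ x ≤ 0, f x = 0) {s : ℝ} (h : IsPhaseCurveOn d f x y (Ici s))
    (hx : x s = 0) (hy : y s < 0) {t : ℝ} (hst : s < t) : x t < 0 := by
  have hstrict {b : ℝ} (hneg : ∀ τ ∈ Icc s b, y τ < 0) : StrictAntiOn x (Icc s b) :=
    strictAntiOn_of_forall_hasDerivWithinAt (convex_Icc s b)
      (h.mono Icc_subset_Ici_self).deriv_x hneg
  suffices hneg : ∀ τ, s ≤ τ → y τ < 0 by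
    simpa only [hx] using hstrict (fun τ hτ => hneg τ hτ.1) (left_mem_Icc.2 hst.le)
      (right_mem_Icc.2 hst.le) hst
  intro b hb
  by_contra! hyb
  obtain ⟨r, hr, hyr, hbefore⟩ := exists_first_zero (f := fun τ => -y τ)
    (h.continuousOn_y.mono Icc_subset_Ici_self).neg hb (by linarith) (by linarith)
  have hcurve := h.mono (J := Icc s r) Icc_subset_Ici_self
  have hxneg : ∀ τ ∈ Icc s r, x τ ≤ 0 := fun τ hτ => by
    have hanti := antitoneOn_of_hasDerivWithinAt_nonpos (convex_Icc s r) hcurve.continuousOn_x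
      (fun τ hτ => (hcurve.deriv_x τ (interior_subset hτ)).mono interior_subset) fun τ hτ => by
        rw [interior_Icc] at hτ
        linarith [hbefore τ ⟨hτ.1.le, hτ.2⟩]
    simpa only [hx] using hanti (left_mem_Icc.2 hr.1.le) hτ hτ.1
  have hexp (τ : ℝ) : HasDerivAt (fun τ => Real.exp (d * τ)) (d * Real.exp (d * τ)) τ := by
    simpa [mul_comm] using ((hasDerivAt_id τ).const_mul d).exp
  have hconst : ‖Real.exp (d * r) * y r - Real.exp (d * s) * y s‖ ≤ 0 * ‖r - s‖ :=
    (convex_Icc s r).norm_image_sub_le_of_norm_hasDerivWithin_le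
      (fun τ hτ => (hexp τ).hasDerivWithinAt.mul (hcurve.deriv_y τ hτ))
      (fun τ hτ => by
        rw [hf _ (hxneg τ hτ), norm_le_zero_iff]
        ring)
      (left_mem_Icc.2 hr.1.le) (right_mem_Icc.2 hr.1.le)
  have hlost : Real.exp (d * s) * y s = 0 := by
    rw [neg_eq_zero.1 hyr, mul_zero, zero_sub, norm_neg, zero_mul] at hconst
    exact norm_le_zero_iff.1 hconst
  exact (mul_neg_of_pos_of_neg (Real.exp_pos _) hy).ne hlost

end IsPhaseCurveOn

namespace IsTrajectory

variable {t : ℝ}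

lemma exists_pos (h : IsTrajectory d f α x y) (hα : 0 < α) :
    ∃ δ, 0 < δ ∧ ∀ t ∈ Ioc 0 δ, 0 < x t := by
  have hpos : ∀ᶠ t in 𝓝[≥] 0, 0 < y t :=
    (h.phaseCurve.continuousOn_y 0 self_mem_Ici).eventually (lt_mem_nhds (by rwa [h.y_zero]))
  obtain ⟨δ, hδ, hyδ⟩ := mem_nhdsGE_iff_exists_Icc_subset.1 hpos
  have hmono := strictMonoOn_of_forall_hasDerivWithinAt (convex_Icc 0 δ)
    (h.phaseCurve.mono Icc_subset_Ici_self).deriv_x fun t ht => hyδ ht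
  refine ⟨δ, hδ, fun t ht => ?_⟩
  simpa only [h.x_zero] using hmono (left_mem_Icc.2 (mem_Ioi.1 hδ).le) (Ioc_subset_Icc_self ht) ht.1

lemma y_ne_zero_of_x_eq_zero (hf : LocallyLipschitz f) (hf0 : f 0 = 0)
    (h : IsTrajectory d f α x y) (hα : α ≠ 0) (ht : 0 ≤ t) (hx : x t = 0) : y t ≠ 0 := by
  intro hy
  have hrest : IsPhaseCurveOn d f (fun _ => 0) (fun _ => 0) (Ici 0) :=
    ⟨fun t _ => hasDerivWithinAt_const t _ 0, fun t _ => by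
      simpa [hf0] using hasDerivWithinAt_const t _ (0 : ℝ)⟩
  exact hα (h.y_zero.symm.trans
    (h.phaseCurve.eqOn hf ordConnected_Ici hrest ht hx hy self_mem_Ici).2)

lemma pos_or_crosses (hW : IsOneSidedWell f V) (h : IsTrajectory d f α x y) (hα : 0 < α) :
    (∀ t > 0, 0 < x t) ∨
      ∃ s > 0, x s = 0 ∧ (∀ t ∈ Ioo 0 s, 0 < x t) ∧ ∀ t > s, x t < 0 := by
  refine or_iff_not_imp_left.2 fun hnot => ?_
  push Not at hnot
  obtain ⟨b, hb0, hb⟩ := hnot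
  obtain ⟨δ, hδ, hpos⟩ := h.exists_pos hα
  have hδb : δ ≤ b := by
    by_contra! hlt
    exact hb.not_gt (hpos b ⟨hb0, hlt.le⟩)
  obtain ⟨s, hs, hxs, hbefore⟩ := exists_first_zero
    (h.phaseCurve.continuousOn_x.mono fun t ht => hδ.le.trans ht.1) hδb (hpos δ ⟨hδ, le_rfl⟩) hb
  have hs0 : 0 < s := hδ.trans hs.1
  have hpos_s : ∀ t ∈ Ioo 0 s, 0 < x t := fun t ht => by
    rcases le_total t δ with htδ | hδt
    · exact hpos t ⟨ht.1, htδ⟩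
    · exact hbefore t ⟨hδt, ht.2⟩
  have hys : y s ≤ 0 := by
    have hslope := ((h.hasDerivWithinAt_x hs0.le).hasDerivAt (Ici_mem_nhds hs0)).hasDerivWithinAt
      (s := Iio s)
    rw [hasDerivWithinAt_iff_tendsto_slope' self_notMem_Iio] at hslope
    refine le_of_tendsto hslope ?_
    filter_upwards [Ioo_mem_nhdsLT hs0] with t ht
    rw [slope_def_field, hxs]
    exact div_nonpos_of_nonneg_of_nonpos (by linarith [hpos_s t ht]) (by linarith [ht.2])
  have hys' : y s < 0 := hys.lt_of_ne (h.y_ne_zero_of_x_eq_zero hW.locallyLipschitz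
    (hW.force_of_nonpos 0 le_rfl) hα.ne' hs0.le hxs)
  exact ⟨s, hs0, hxs, hpos_s, fun t ht =>
    (h.phaseCurve.mono (Ici_subset_Ici.2 hs0.le)).neg_of_zero hW.force_of_nonpos hxs hys' ht⟩

lemma exists_isCompact_of_pos (hW : IsOneSidedWell f V) (hd : 0 ≤ d) (h : IsTrajectory d f α x y)
    (hx : ∀ t > 0, 0 < x t) : ∃ C, IsCompact C ∧ ∀ t ∈ Ici 0, (x t, y t) ∈ C := by
  obtain ⟨B, hB⟩ := hW.exists_neg_le_potential
  obtain ⟨M, hM⟩ := eventually_atTop.1 (hW.tendsto_atTop.eventually_gt_atTop (α ^ 2 / 2))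
  refine ⟨Icc 0 M ×ˢ Icc (-√(α ^ 2 + 2 * B)) (√(α ^ 2 + 2 * B)), isCompact_Icc.prod isCompact_Icc,
    fun t ht => ⟨⟨?_, ?_⟩, abs_le.1 (Real.abs_le_sqrt ?_)⟩⟩
  · rcases (mem_Ici.1 ht).eq_or_lt with rfl | ht
    exacts [h.x_zero.ge, (hx t ht).le]
  · by_contra! hlt
    have henergy := h.energy_le hW hd ht
    unfold energy at henergy
    linarith [hM _ hlt.le, sq_nonneg (y t)]
  · have henergy := h.energy_le hW hd ht
    unfold energy at henergy
    linarith [hB (x t)]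

end IsTrajectory

/-- A one-sided well whose potential decreases from `0` to its minimum at the rest point `e` and
increases afterwards. -/
structure IsSingleWell (f V : ℝ → ℝ) (e : ℝ) : Prop extends IsOneSidedWell f V where
  equilibrium_pos : 0 < e
  force_neg : ∀ x ∈ Ioo 0 e, f x < 0
  force_pos : ∀ x > e, 0 < f x

/-- A trajectory that stays positive and never loses all its energy. -/
structure IsFastTrajectory (d : ℝ) (f V : ℝ → ℝ) (α : ℝ) (x y : ℝ → ℝ) : Prop
    extends IsTrajectory d f α x y where
  pos : ∀ t > 0, 0 < x t
  energy_nonneg : ∀ t, 0 ≤ t → 0 ≤ energy V (x t) (y t)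

/-- On `[S, ∞)` the phase curve moves monotonically towards the origin, through positions at which
the force `-f` points away from the origin. -/
structure IsDescentOn (d : ℝ) (f : ℝ → ℝ) (S : ℝ) (x y : ℝ → ℝ) : Prop where
  phaseCurve : IsPhaseCurveOn d f x y (Ici S)
  x_pos : ∀ t, S ≤ t → 0 < x t
  y_neg : ∀ t, S ≤ t → y t < 0
  force_neg : ∀ t, S ≤ t → f (x t) < 0
  tendsto_x : Tendsto x atTop (𝓝 0)
  tendsto_y : Tendsto y atTop (𝓝 0)

namespace IsSingleWell

lemma potential_neg (hW : IsSingleWell f V e) {x : ℝ} (hx : x ∈ Ioc 0 e) : V x < 0 := by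
  have hanti : StrictAntiOn V (Icc 0 e) := strictAntiOn_of_hasDerivWithinAt_neg (convex_Icc 0 e)
    hW.continuous_potential.continuousOn (fun t _ => (hW.hasDerivAt t).hasDerivWithinAt)
    fun t ht => hW.force_neg t (by rwa [interior_Icc] at ht)
  simpa only [hW.potential_zero] using
    hanti (left_mem_Icc.2 hW.equilibrium_pos.le) (Ioc_subset_Icc_self hx) hx.1

lemma eq_zero_or_eq_of_force_eq_zero (hW : IsSingleWell f V e) {x : ℝ} (hx : 0 ≤ x)
    (hfx : f x = 0) : x = 0 ∨ x = e := by
  rcases hx.eq_or_lt with rfl | hx0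
  · exact Or.inl rfl
  · refine Or.inr (le_antisymm ?_ ?_) <;> by_contra! hlt
    · exact (hW.force_pos x hlt).ne' hfx
    · exact (hW.force_neg x ⟨hx0, hlt⟩).ne hfx

end IsSingleWell

namespace IsTrajectory

variable {t : ℝ}

lemma tendsto_y_zero_of_pos (hW : IsOneSidedWell f V) (hd : 0 < d) (h : IsTrajectory d f α x y)
    (hx : ∀ t > 0, 0 < x t) : Tendsto y atTop (𝓝 0) := by
  obtain ⟨C, hC, hmaps⟩ := h.exists_isCompact_of_pos hW hd.le hx
  exact h.phaseCurve.tendsto_y_zero hW.locallyLipschitz hW.hasDerivAt hd hC hmaps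

lemma exists_tendsto_of_pos (hW : IsSingleWell f V e) (hd : 0 < d) (h : IsTrajectory d f α x y)
    (hx : ∀ t > 0, 0 < x t) : ∃ z, (z = 0 ∨ z = e) ∧ Tendsto x atTop (𝓝 z) ∧
      Tendsto (fun t => energy V (x t) (y t)) atTop (𝓝 (V z)) := by
  obtain ⟨C, hC, hmaps⟩ := h.exists_isCompact_of_pos hW.toIsOneSidedWell hd.le hx
  obtain ⟨L, hL, -⟩ := h.phaseCurve.exists_tendsto_energy hW.hasDerivAt hd.le hC hmaps
  have hy := h.tendsto_y_zero_of_pos hW.toIsOneSidedWell hd hx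
  have hfx : Tendsto (f ∘ x) atTop (𝓝 0) :=
    h.phaseCurve.tendsto_force_zero (f := f) hW.locallyLipschitz hW.hasDerivAt hd hC hmaps
  have hVx : Tendsto (V ∘ x) atTop (𝓝 L) := by
    simpa [energy, Function.comp_def] using hL.sub ((hy.pow 2).div_const 2)
  have hcompact : IsCompact (Prod.fst '' C ∩ Ici 0) := (hC.image continuous_fst).inter_right
    isClosed_Ici
  have hmem : ∀ᶠ t in atTop, x t ∈ Prod.fst '' C ∩ Ici 0 := by
    filter_upwards [eventually_gt_atTop 0] with t ht
    exact ⟨mem_image_of_mem _ (hmaps t (mem_Ici.2 ht.le)), (hx t ht).le⟩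
  have hcluster {z : ℝ} (hz0 : 0 ≤ z) (hz : MapClusterPt z atTop x) : (z = 0 ∨ z = e) ∧ V z = L :=
    ⟨hW.eq_zero_or_eq_of_force_eq_zero hz0
      (apply_eq_of_mapClusterPt hW.locallyLipschitz.continuous.continuousAt hz hfx),
      apply_eq_of_mapClusterPt (hW.hasDerivAt z).continuousAt hz hVx⟩
  obtain ⟨z, hzmem, hz⟩ := hcompact.exists_mapClusterPt_of_frequently hmem.frequently
  obtain ⟨hzeq, hVz⟩ := hcluster hzmem.2 hz
  refine ⟨z, hzeq, hcompact.tendsto_nhds_of_unique_mapClusterPt hmem fun w hwmem hw => ?_,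
    hVz ▸ hL⟩
  obtain ⟨hweq, hVw⟩ := hcluster hwmem.2 hw
  have hVe := hW.potential_neg (right_mem_Ioc.2 hW.equilibrium_pos)
  have hV0 := hW.potential_zero
  rcases hzeq with rfl | rfl <;> rcases hweq with rfl | rfl <;> first | rfl | linarith

lemma tendsto_equilibrium (hW : IsSingleWell f V e) (hd : 0 < d) (h : IsTrajectory d f α x y)
    (hx : ∀ t > 0, 0 < x t) (ht : 0 ≤ t) (hE : energy V (x t) (y t) < 0) :
    Tendsto x atTop (𝓝 e) := by
  obtain ⟨z, rfl | rfl, hxz, hEz⟩ := h.exists_tendsto_of_pos hW hd hx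
  · have hle : V 0 ≤ energy V (x t) (y t) := le_of_tendsto hEz <| by
      filter_upwards [eventually_ge_atTop t] with τ hτ
      exact h.phaseCurve.antitoneOn_energy hW.hasDerivAt hd.le (convex_Ici 0) ht (ht.trans hτ) hτ
    linarith [hW.potential_zero]
  · exact hxz

end IsTrajectory

namespace IsFastTrajectory

lemma tendsto_x_zero (hW : IsSingleWell f V e) (hd : 0 < d) (h : IsFastTrajectory d f V α x y) :
    Tendsto x atTop (𝓝 0) := by
  obtain ⟨z, rfl | rfl, hxz, hEz⟩ := h.toIsTrajectory.exists_tendsto_of_pos hW hd h.pos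
  · exact hxz
  · have hge : 0 ≤ V z := ge_of_tendsto hEz <| by
      filter_upwards [eventually_ge_atTop 0] with t ht using h.energy_nonneg t ht
    exact absurd hge (hW.potential_neg (right_mem_Ioc.2 hW.equilibrium_pos)).not_ge

lemma exists_isDescentOn (hW : IsSingleWell f V e) (hd : 0 < d)
    (h : IsFastTrajectory d f V α x y) : ∃ S > 0, IsDescentOn d f S x y := by
  have hx := h.tendsto_x_zero hW hd
  obtain ⟨S, hS⟩ := eventually_atTop.1
    ((hx.eventually_lt_const hW.equilibrium_pos).and (eventually_gt_atTop 0))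
  have hpos : ∀ t, S ≤ t → 0 < t := fun t ht => (hS t ht).2
  have hmem : ∀ t, S ≤ t → x t ∈ Ioo 0 e := fun t ht => ⟨h.pos t (hpos t ht), (hS t ht).1⟩
  have hy_ne : ∀ t, S ≤ t → y t ≠ 0 := fun t ht hy => by
    have hE := h.energy_nonneg t (hpos t ht).le
    simp only [energy, hy] at hE
    linarith [hW.potential_neg (Ioo_subset_Ioc_self (hmem t ht))]
  refine ⟨S, hpos S le_rfl, h.phaseCurve.mono (Ici_subset_Ici.2 (hpos S le_rfl).le),
    fun t ht => (hmem t ht).1, fun t ht => ?_, fun t ht => hW.force_neg _ (hmem t ht), hx,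
    h.toIsTrajectory.tendsto_y_zero_of_pos hW.toIsOneSidedWell hd h.pos⟩
  by_contra! hyt
  have hcurve := h.phaseCurve.mono (Ici_subset_Ici.2 (hpos t ht).le)
  have hy_pos : ∀ τ ∈ Ici t, 0 < y τ := fun τ hτ => by
    by_contra! hyτ
    obtain ⟨s, hs, hys, -⟩ := exists_first_zero
      (hcurve.continuousOn_y.mono Icc_subset_Ici_self) hτ (hyt.lt_of_ne (hy_ne t ht).symm) hyτ
    exact hy_ne s (ht.trans hs.1.le) hys
  have hmono := strictMonoOn_of_forall_hasDerivWithinAt (convex_Ici t) hcurve.deriv_x hy_pos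
  refine (hmem t ht).1.not_ge (ge_of_tendsto hx ?_)
  filter_upwards [eventually_ge_atTop t] with τ hτ
  exact hmono.monotoneOn self_mem_Ici hτ hτ

end IsFastTrajectory

namespace IsDescentOn

variable {S S' : ℝ} {x' y' : ℝ → ℝ}

lemma strictAntiOn_x (h : IsDescentOn d f S x y) : StrictAntiOn x (Ici S) :=
  strictAntiOn_of_forall_hasDerivWithinAt (convex_Ici S) h.phaseCurve.deriv_x h.y_neg

lemma hasDerivAt_x (h : IsDescentOn d f S x y) {t : ℝ} (ht : S < t) : HasDerivAt x (y t) t :=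
  (h.phaseCurve.deriv_x t ht.le).hasDerivAt (Ici_mem_nhds ht)

lemma hasDerivAt_y (h : IsDescentOn d f S x y) {t : ℝ} (ht : S < t) :
    HasDerivAt y (-d * y t - f (x t)) t :=
  (h.phaseCurve.deriv_y t ht.le).hasDerivAt (Ici_mem_nhds ht)

lemma exists_velocity_graph (h : IsDescentOn d f S x y) :
    ∃ Y : ℝ → ℝ, (∀ a ∈ Ioo 0 (x S), Y a < 0 ∧ HasDerivAt Y (-d - f a / Y a) a ∧
      ∃ t > S, x t = a ∧ y t = Y a) ∧ Tendsto Y (𝓝[>] 0) (𝓝 0) := by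
  obtain ⟨g, hg, hgcont, hglim⟩ := exists_inverse_of_strictAntiOn_Ici h.strictAntiOn_x
    h.phaseCurve.continuousOn_x h.tendsto_x
  refine ⟨y ∘ g, fun a ha => ⟨h.y_neg _ (hg a ha).1.le, ?_, g a, (hg a ha).1, (hg a ha).2, rfl⟩,
    h.tendsto_y.comp hglim⟩
  have hne := (h.y_neg _ (hg a ha).1.le).ne
  have hnhds := isOpen_Ioo.mem_nhds ha
  have hderiv : HasDerivAt g (y (g a))⁻¹ a := HasDerivAt.of_local_left_inverse
    (hgcont.continuousAt hnhds) (h.hasDerivAt_x (hg a ha).1) hne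
    (by filter_upwards [hnhds] with b hb using (hg b hb).2)
  refine ((h.hasDerivAt_y (hg a ha).1).comp a hderiv).congr_deriv ?_
  rw [(hg a ha).2, Function.comp_apply]
  field_simp

/-- The difference `D` of two velocity graphs satisfies `dD/da = f(a) / (Y Y') * D`, where `f` is
negative; hence `D ^ 2` is antitone, and it vanishes at the origin. -/
lemma exists_meet (h : IsDescentOn d f S x y) (h' : IsDescentOn d f S' x' y') :
    ∃ t > S, ∃ t' > S', x t = x' t' ∧ y t = y' t' := by
  obtain ⟨Y, hY, hlim⟩ := h.exists_velocity_graph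
  obtain ⟨Y', hY', hlim'⟩ := h'.exists_velocity_graph
  set b := min (x S) (x' S')
  have hmem : ∀ a ∈ Ioo 0 b, a ∈ Ioo 0 (x S) ∧ a ∈ Ioo 0 (x' S') := fun a ha =>
    ⟨⟨ha.1, ha.2.trans_le (min_le_left _ _)⟩, ha.1, ha.2.trans_le (min_le_right _ _)⟩
  have hb : 0 < b := lt_min (h.x_pos S le_rfl) (h'.x_pos S' le_rfl)
  have hanti : AntitoneOn (fun a => (Y a - Y' a) ^ 2) (Ioo 0 b) := by
    refine antitoneOn_of_forall_hasDerivWithinAt (convex_Ioo 0 b)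
      (f' := fun a => 2 * (f a / (Y a * Y' a)) * (Y a - Y' a) ^ 2) (fun a ha => ?_) fun a ha => ?_
    all_goals
      obtain ⟨hneg, hderiv, t, ht, rfl, -⟩ := hY a (hmem a ha).1
      obtain ⟨hneg', hderiv', -⟩ := hY' _ (hmem _ ha).2
    · refine ((hderiv.sub hderiv').pow 2).hasDerivWithinAt.congr_deriv ?_
      rw [Pi.sub_apply]
      field_simp [hneg.ne, hneg'.ne]
      ring
    · have hquot := div_neg_of_neg_of_pos (h.force_neg t ht.le) (mul_pos_of_neg_of_neg hneg hneg')
      exact mul_nonpos_of_nonpos_of_nonneg (by linarith) (sq_nonneg _)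
  have hzero : (Y (b / 2) - Y' (b / 2)) ^ 2 ≤ 0 := by
    have hlim0 : Tendsto (fun a => (Y a - Y' a) ^ 2) (𝓝[>] 0) (𝓝 0) := by
      simpa using (hlim.sub hlim').pow 2
    refine ge_of_tendsto hlim0 ?_
    filter_upwards [Ioo_mem_nhdsGT (half_pos hb)] with a ha
    exact hanti ⟨ha.1, by linarith [ha.2]⟩ ⟨half_pos hb, half_lt_self hb⟩ ha.2.le
  have heq : Y (b / 2) = Y' (b / 2) :=
    sub_eq_zero.1 (pow_eq_zero_iff two_ne_zero |>.1 (le_antisymm hzero (sq_nonneg _)))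
  obtain ⟨hmid, hmid'⟩ := hmem _ ⟨half_pos hb, half_lt_self hb⟩
  obtain ⟨-, -, t, ht, hx, hy⟩ := hY _ hmid
  obtain ⟨-, -, t', ht', hx', hy'⟩ := hY' _ hmid'
  exact ⟨t, ht, t', ht', hx.trans hx'.symm, (hy.trans heq).trans hy'.symm⟩

end IsDescentOn

lemma IsPhaseCurveOn.comp_add_const {s T : ℝ} (h : IsPhaseCurveOn d f x y (Ici T)) :
    IsPhaseCurveOn d f (fun t => x (t + s)) (fun t => y (t + s)) (Ici (T - s)) := by
  have hmaps : MapsTo (· + s) (Ici (T - s)) (Ici T) := fun t ht => by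
    simpa [sub_le_iff_le_add] using ht
  have hshift (t : ℝ) : HasDerivWithinAt (· + s) 1 (Ici (T - s)) t :=
    ((hasDerivAt_id t).add_const s).hasDerivWithinAt
  exact ⟨fun t ht => ((h.deriv_x _ (hmaps ht)).comp t (hshift t) hmaps).congr_deriv (mul_one _),
    fun t ht => ((h.deriv_y _ (hmaps ht)).comp t (hshift t) hmaps).congr_deriv (mul_one _)⟩

namespace IsTrajectory

variable {α' t t' : ℝ} {x' y' : ℝ → ℝ}

/-- If two trajectories meet, the later one is a time shift of the earlier one; by positivity the
shift is `0`. -/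
lemma slope_eq_of_meet (hf : LocallyLipschitz f) (h : IsTrajectory d f α x y)
    (h' : IsTrajectory d f α' x' y') (hx' : ∀ t > 0, 0 < x' t) (ht : 0 ≤ t) (htt' : t ≤ t')
    (hx : x t = x' t') (hy : y t = y' t') : α = α' := by
  have hshift := (h'.phaseCurve.comp_add_const (s := t' - t)).mono
    (Ici_subset_Ici.2 (by linarith : 0 - (t' - t) ≤ 0))
  obtain ⟨hx0, hy0⟩ := h.phaseCurve.eqOn hf ordConnected_Ici hshift ht (by simpa using hx)
    (by simpa using hy) self_mem_Ici
  rw [h.x_zero, zero_add] at hx0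
  rw [h.y_zero, zero_add] at hy0
  rcases htt'.eq_or_lt with rfl | hlt
  · rw [hy0, sub_self, h'.y_zero]
  · exact absurd hx0 (hx' _ (sub_pos.2 hlt)).ne

end IsTrajectory

lemma IsFastTrajectory.slope_eq {α' : ℝ} {x' y' : ℝ → ℝ} (hW : IsSingleWell f V e)
    (hd : 0 < d) (h : IsFastTrajectory d f V α x y) (h' : IsFastTrajectory d f V α' x' y') :
    α = α' := by
  obtain ⟨S, hS, hdesc⟩ := h.exists_isDescentOn hW hd
  obtain ⟨S', hS', hdesc'⟩ := h'.exists_isDescentOn hW hd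
  obtain ⟨t, ht, t', ht', hx, hy⟩ := hdesc.exists_meet hdesc'
  rcases le_total t t' with hle | hle
  · exact h.toIsTrajectory.slope_eq_of_meet hW.locallyLipschitz h'.toIsTrajectory h'.pos
      (hS.trans ht).le hle hx hy
  · exact (h'.toIsTrajectory.slope_eq_of_meet hW.locallyLipschitz h.toIsTrajectory h.pos
      (hS'.trans ht').le hle hx.symm hy.symm).symm

/-- The slopes of the trajectories that leave the half-line `x ≥ 0`. -/
def escapingSlopes (d : ℝ) (f : ℝ → ℝ) : Set ℝ := slopesReaching d f {z | z.1 < 0}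

/-- The slopes of the trajectories that fall to negative energy, hence into the well. -/
def trappedSlopes (d : ℝ) (f V : ℝ → ℝ) : Set ℝ := slopesReaching d f {z | energy V z.1 z.2 < 0}

lemma IsPhaseCurveOn.energy_add_le {η s t : ℝ} (hV : ∀ x, HasDerivAt V (f x) x) (hd : 0 ≤ d)
    (hη : 0 ≤ η) (hst : s ≤ t) (h : IsPhaseCurveOn d f x y (Icc s t))
    (hy : ∀ τ ∈ Icc s t, η ≤ y τ) :
    energy V (x t) (y t) + d * η * (x t - x s) ≤ energy V (x s) (y s) := by
  have hanti : AntitoneOn (fun τ => energy V (x τ) (y τ) + d * η * x τ) (Icc s t) :=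
    antitoneOn_of_forall_hasDerivWithinAt (convex_Icc s t)
      (fun τ hτ => (h.hasDerivWithinAt_energy hV hτ).add ((h.deriv_x τ hτ).const_mul _))
      fun τ hτ => by
        have hprod := mul_nonneg (mul_nonneg hd (hη.trans (hy τ hτ))) (sub_nonneg.2 (hy τ hτ))
        linarith
  have hle := hanti (left_mem_Icc.2 hst) (right_mem_Icc.2 hst) hst
  simp only at hle
  linarith

namespace IsTrajectory

lemma exists_turning (hW : IsSingleWell f V e) (hd : 0 < d) (h : IsTrajectory d f α x y)
    (hα : 0 < α) (hE : ∀ t, 0 ≤ t → 0 ≤ energy V (x t) (y t)) :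
    ∃ s > 0, y s = 0 ∧ e < x s ∧ ∀ t ∈ Icc 0 s, 0 ≤ y t := by
  have hturn : ∃ b, 0 ≤ b ∧ y b ≤ 0 := by
    by_contra! hy
    have hmono := strictMonoOn_of_forall_hasDerivWithinAt (convex_Ici 0) h.phaseCurve.deriv_x hy
    have hpos : ∀ t > 0, 0 < x t := fun t ht => by
      simpa only [h.x_zero] using hmono self_mem_Ici (mem_Ici.2 ht.le) ht
    refine (hpos 1 one_pos).not_ge
      (ge_of_tendsto (IsFastTrajectory.tendsto_x_zero hW hd ⟨h, hpos, hE⟩) ?_)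
    filter_upwards [eventually_ge_atTop 1] with t ht
    exact hmono.monotoneOn (mem_Ici.2 zero_le_one) (mem_Ici.2 (zero_le_one.trans ht)) ht
  obtain ⟨b, hb0, hb⟩ := hturn
  obtain ⟨s, hs, hys, hbefore⟩ := exists_first_zero
    (h.phaseCurve.continuousOn_y.mono Icc_subset_Ici_self) hb0 (by rwa [h.y_zero]) hb
  have hy : ∀ t ∈ Icc 0 s, 0 ≤ y t := fun t ht => by
    rcases ht.2.eq_or_lt with rfl | hts
    exacts [hys.ge, (hbefore t ⟨ht.1, hts⟩).le]
  have hmono := monotoneOn_of_forall_hasDerivWithinAt (convex_Icc 0 s)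
    (h.phaseCurve.mono Icc_subset_Ici_self).deriv_x hy
  have hxs : 0 ≤ x s := by
    simpa only [h.x_zero] using hmono (left_mem_Icc.2 hs.1.le) (right_mem_Icc.2 hs.1.le) hs.1.le
  have hxs_ne : x s ≠ 0 := fun hxs => h.y_ne_zero_of_x_eq_zero hW.locallyLipschitz
    (hW.force_of_nonpos 0 le_rfl) hα.ne' hs.1.le hxs hys
  refine ⟨s, hs.1, hys, ?_, hy⟩
  by_contra! hle
  have hVneg := hW.potential_neg ⟨hxs.lt_of_ne' hxs_ne, hle⟩
  have hEs := hE s hs.1.le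
  simp only [energy, hys] at hEs
  linarith

end IsTrajectory

lemma exists_le_neg_sq_div_two {s : Set ℝ} (hs : IsCompact s) (hV : ContinuousOn V s)
    (hneg : ∀ x ∈ s, V x < 0) : ∃ η > 0, ∀ x ∈ s, V x ≤ -(η ^ 2 / 2) := by
  rcases s.eq_empty_or_nonempty with rfl | hne
  · exact ⟨1, one_pos, by simp⟩
  obtain ⟨z, hz, hmax⟩ := hs.exists_isMaxOn hne hV
  refine ⟨√(-2 * V z), Real.sqrt_pos.2 (by linarith [hneg z hz]), fun x hx => ?_⟩
  rw [Real.sq_sqrt (by linarith [hneg z hz])]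
  linarith [isMaxOn_iff.1 hmax x hx]

/-- A trajectory that keeps nonnegative energy crosses `[e / 2, e]` at speed at least `η`, which
costs it the energy `d η e / 2`. -/
lemma exists_Ioo_subset_trappedSlopes (hW : IsSingleWell f V e) (hd : 0 < d) :
    ∃ ε > 0, Ioo 0 ε ⊆ trappedSlopes d f V := by
  have he := hW.equilibrium_pos
  obtain ⟨η, hη, hVη⟩ := exists_le_neg_sq_div_two (isCompact_Icc (a := e / 2) (b := e))
    hW.continuous_potential.continuousOn fun x hx => hW.potential_neg ⟨by linarith [hx.1], hx.2⟩
  refine ⟨√(d * η * e), Real.sqrt_pos.2 (by positivity), fun α hα => ?_⟩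
  obtain ⟨x, y, h⟩ := exists_isTrajectory (d := d) hW.toIsOneSidedWell hd.le α
  refine ⟨x, y, h, ?_⟩
  by_contra! hE
  simp only [mem_ofPred_eq, not_lt] at hE
  obtain ⟨s, hs0, -, hxs, hy⟩ := h.exists_turning hW hd hα.1 hE
  have hcurve := h.phaseCurve.mono (J := Icc 0 s) Icc_subset_Ici_self
  have hmono := monotoneOn_of_forall_hasDerivWithinAt (convex_Icc 0 s) hcurve.deriv_x hy
  have hreach {c : ℝ} (hc : c ∈ Icc 0 e) : ∃ t ∈ Icc 0 s, x t = c :=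
    intermediate_value_Icc hs0.le hcurve.continuousOn_x
      ⟨by rw [h.x_zero]; exact hc.1, hc.2.trans hxs.le⟩
  obtain ⟨t₁, ht₁, hx₁⟩ := hreach ⟨(half_pos he).le, (half_lt_self he).le⟩
  obtain ⟨t₂, ht₂, hx₂⟩ := hreach ⟨he.le, le_rfl⟩
  have ht₁₂ : t₁ ≤ t₂ := by
    by_contra! hlt
    linarith [hmono ht₂ ht₁ hlt.le]
  have hsub := Icc_subset_Icc ht₁.1 ht₂.2
  have hspeed : ∀ t ∈ Icc t₁ t₂, η ≤ y t := fun t ht => by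
    have hxt : x t ∈ Icc (e / 2) e :=
      ⟨hx₁ ▸ hmono ht₁ (hsub ht) ht.1, hx₂ ▸ hmono (hsub ht) ht₂ ht.2⟩
    have hEt := hE t (hsub ht).1
    unfold energy at hEt
    exact le_of_sq_le_sq (by linarith [hVη _ hxt]) (hy t (hsub ht))
  have hloss := (hcurve.mono hsub).energy_add_le hW.hasDerivAt hd.le hη.le ht₁₂ hspeed
  have hα2 : α ^ 2 < d * η * e := (Real.lt_sqrt hα.1.le).1 hα.2
  rw [hx₁, hx₂] at hloss
  linarith [hx₁ ▸ h.energy_le hW.toIsOneSidedWell hd.le ht₁.1, hx₂ ▸ hE t₂ ht₂.1]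

lemma IsPhaseCurveOn.monotoneOn_exp_mul_energy (hV : ∀ x, HasDerivAt V (f x) x) (hd : 0 ≤ d)
    {B : ℝ} (hB : ∀ x, -B ≤ V x) (hI : Convex ℝ I) (h : IsPhaseCurveOn d f x y I) :
    MonotoneOn (fun t => Real.exp (2 * d * t) * (energy V (x t) (y t) + B)) I :=
  monotoneOn_of_forall_hasDerivWithinAt hI
    (f' := fun t => 2 * d * Real.exp (2 * d * t) * (V (x t) + B))
    (fun t ht => (((hasDerivAt_id t).const_mul (2 * d)).exp.hasDerivWithinAt.mul
      ((h.hasDerivWithinAt_energy hV ht).add_const B)).congr_deriv <| by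
        simp only [energy, id]
        ring)
    fun t _ => mul_nonneg (by positivity) (by linarith [hB (x t)])

lemma exists_le_energy_of_isTrajectory (hW : IsOneSidedWell f V) (hd : 0 ≤ d) (N T : ℝ) :
    ∃ α > 0, ∀ x y, IsTrajectory d f α x y → ∀ t ∈ Icc 0 T, N ≤ energy V (x t) (y t) := by
  obtain ⟨B, hB⟩ := hW.exists_neg_le_potential
  have hB0 : 0 ≤ B := by linarith [hB 0, hW.potential_zero]
  refine ⟨√(2 * (Real.exp (2 * d * T) * (|N + B| + 1))), Real.sqrt_pos.2 (by positivity),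
    fun x y h t ht => ?_⟩
  have hmono := h.phaseCurve.monotoneOn_exp_mul_energy hW.hasDerivAt hd hB (convex_Ici 0)
    self_mem_Ici (mem_Ici.2 ht.1) ht.1
  simp only [energy, h.x_zero, h.y_zero, hW.potential_zero, mul_zero, Real.exp_zero, one_mul,
    Real.sq_sqrt (show 0 ≤ 2 * (Real.exp (2 * d * T) * (|N + B| + 1)) by positivity)] at hmono
  have hexp : Real.exp (2 * d * t) * (|N + B| + 1) ≤ Real.exp (2 * d * T) * (|N + B| + 1) := by
    gcongr
    exact ht.2
  have hle : |N + B| + 1 ≤ y t ^ 2 / 2 + V (x t) + B :=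
    le_of_mul_le_mul_left (by linarith) (Real.exp_pos (2 * d * t))
  unfold energy
  linarith [le_abs_self (N + B)]

namespace IsSingleWell

lemma exists_neg_mul_le_force (hW : IsSingleWell f V e) :
    ∃ κ ≥ 0, ∀ x > 0, -κ * x ≤ f x := by
  obtain ⟨K, hK⟩ := hW.locallyLipschitz.locallyLipschitzOn.exists_lipschitzOnWith_of_compact
    (isCompact_Icc (a := 0) (b := e))
  refine ⟨K, K.2, fun x hx => ?_⟩
  rcases le_or_gt x e with hxe | hxe
  · have hdist := hK.dist_le_mul x ⟨hx.le, hxe⟩ 0 (left_mem_Icc.2 hW.equilibrium_pos.le)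
    rw [hW.force_of_nonpos 0 le_rfl, dist_zero_right, dist_zero_right, Real.norm_of_nonneg hx.le]
      at hdist
    linarith [neg_abs_le (f x), Real.norm_eq_abs (f x)]
  · nlinarith [hW.force_pos x hxe, K.2]

lemma exists_sq_add_one_le (hW : IsSingleWell f V e)
    (hf : Tendsto (fun x => f x / x) atTop atTop) (d : ℝ) :
    ∃ N, ∀ x > 0, ∀ y, N ≤ energy V x y →
      1 / 4 * (1 + (y / x) ^ 2) ≤ (y / x) ^ 2 + d * (y / x) + f x / x := by
  obtain ⟨κ, hκ, hforce⟩ := hW.exists_neg_mul_le_force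
  set G : ℝ := 1 + 2 * d ^ 2 + 4 * κ
  obtain ⟨X, hX⟩ := eventually_atTop.1 (hf.eventually_ge_atTop G)
  obtain ⟨M, hM⟩ := (isCompact_Icc (a := 0) (b := X)).exists_bound_of_continuousOn
    hW.continuous_potential.continuousOn
  refine ⟨G * X ^ 2 / 2 + M, fun x hx y hE => ?_⟩
  have hκx : -κ ≤ f x / x := (le_div_iff₀ hx).2 (hforce x hx)
  rcases le_or_gt X x with hXx | hxX
  · nlinarith [hX x hXx, sq_nonneg (y / x), sq_nonneg (y / x + d)]
  · have hy : G * x ^ 2 ≤ y ^ 2 := by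
      have hxX2 : G * x ^ 2 ≤ G * X ^ 2 := by gcongr
      have hVx := (abs_le.1 (hM x ⟨hx.le, hxX.le⟩)).2
      unfold energy at hE
      linarith
    have hslope : G ≤ (y / x) ^ 2 := by rwa [div_pow, le_div_iff₀ (by positivity)]
    nlinarith [sq_nonneg (y / x + d)]

end IsSingleWell

lemma IsPhaseCurveOn.hasDerivWithinAt_div (h : IsPhaseCurveOn d f x y I) {t : ℝ} (ht : t ∈ I)
    (hx : x t ≠ 0) : HasDerivWithinAt (fun t => y t / x t)
      (-((y t / x t) ^ 2 + d * (y t / x t) + f (x t) / x t)) I t :=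
  ((h.deriv_y t ht).div (h.deriv_x t ht) hx).congr_deriv <| by
    field_simp
    ring

/-- As long as the trajectory is positive, `q = y / x` satisfies the Riccati equation
`q' = -(q² + d q + f(x) / x)`; at high energy it must blow down within bounded time. -/
lemma exists_mem_escapingSlopes (hW : IsSingleWell f V e) (hd : 0 ≤ d)
    (hf : Tendsto (fun x => f x / x) atTop atTop) : ∃ α > 0, α ∈ escapingSlopes d f := by
  obtain ⟨N, hN⟩ := hW.exists_sq_add_one_le hf d
  set T : ℝ := 1 + 4 * Real.pi
  obtain ⟨α, hα, hE⟩ := exists_le_energy_of_isTrajectory hW.toIsOneSidedWell hd N T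
  obtain ⟨x, y, h⟩ := exists_isTrajectory hW.toIsOneSidedWell hd α
  refine ⟨α, hα, x, y, h, ?_⟩
  rcases h.pos_or_crosses hW.toIsOneSidedWell hα with hpos | ⟨s, hs, -, -, hneg⟩
  · have hT : 1 ≤ T := by linarith [Real.pi_pos]
    have hmem : ∀ t ∈ Icc 1 T, 0 < x t ∧ t ∈ Icc 0 T := fun t ht =>
      ⟨hpos t (one_pos.trans_le ht.1), zero_le_one.trans ht.1, ht.2⟩
    have hlt := mul_sub_lt_pi_of_riccati hT
      (fun t ht => (h.phaseCurve.mono fun s hs => (hmem s hs).2.1).hasDerivWithinAt_div ht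
        (hmem t ht).1.ne')
      (fun t ht => neg_le_neg (hN _ (hmem t ht).1 _ (hE x y h t (hmem t ht).2)))
    linarith
  · exact ⟨s + 1, by linarith, hneg _ (lt_add_one s)⟩

namespace IsTrajectory

lemma energy_neg_of_le (hW : IsOneSidedWell f V) (hd : 0 ≤ d) (h : IsTrajectory d f α x y)
    {s t : ℝ} (hs : 0 ≤ s) (hst : s ≤ t) (hE : energy V (x s) (y s) < 0) :
    energy V (x t) (y t) < 0 :=
  (h.phaseCurve.antitoneOn_energy hW.hasDerivAt hd (convex_Ici 0) (mem_Ici.2 hs)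
    (mem_Ici.2 (hs.trans hst)) hst).trans_lt hE

lemma pos_of_energy_neg (hW : IsOneSidedWell f V) (hd : 0 ≤ d) (h : IsTrajectory d f α x y)
    (hα : 0 < α) {s : ℝ} (hs : 0 ≤ s) (hE : energy V (x s) (y s) < 0) : ∀ t > 0, 0 < x t := by
  refine (h.pos_or_crosses hW hα).resolve_right fun ⟨r, _, _, _, hneg⟩ => ?_
  have hlate : max r s < max r s + 1 := lt_add_one _
  have hEneg := h.energy_neg_of_le hW hd hs ((le_max_right r s).trans hlate.le) hE
  have hV := hW.potential_of_nonpos (hneg _ ((le_max_left r s).trans_lt hlate)).le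
  unfold energy at hEneg
  linarith [sq_nonneg (y (max r s + 1))]

lemma pos_of_notMem_escapingSlopes (hW : IsOneSidedWell f V) (h : IsTrajectory d f α x y)
    (hα : 0 < α) (hescape : α ∉ escapingSlopes d f) : ∀ t > 0, 0 < x t :=
  (h.pos_or_crosses hW hα).resolve_right fun ⟨s, hs, _, _, hneg⟩ =>
    hescape ⟨x, y, h, s + 1, by linarith, hneg _ (lt_add_one s)⟩

lemma isFastTrajectory (hW : IsOneSidedWell f V) (h : IsTrajectory d f α x y) (hα : 0 < α)
    (hescape : α ∉ escapingSlopes d f) (htrapped : α ∉ trappedSlopes d f V) :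
    IsFastTrajectory d f V α x y where
  toIsTrajectory := h
  pos := h.pos_of_notMem_escapingSlopes hW hα hescape
  energy_nonneg t ht := not_lt.1 fun hE => htrapped ⟨x, y, h, t, ht, hE⟩

end IsTrajectory

lemma notMem_trappedSlopes_of_mem_escapingSlopes (hW : IsOneSidedWell f V) (hd : 0 ≤ d)
    (hα : 0 < α) (hescape : α ∈ escapingSlopes d f) : α ∉ trappedSlopes d f V := by
  obtain ⟨x, y, h, t, ht, hxt⟩ := hescape
  rw [trappedSlopes, h.mem_slopesReaching_iff hW.locallyLipschitz]
  rintro ⟨s, hs, hE⟩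
  rcases ht.eq_or_lt with rfl | ht0
  · exact (show x 0 < 0 from hxt).ne h.x_zero
  · exact (h.pos_of_energy_neg hW hd hα hs hE t ht0).not_gt hxt

lemma exists_separating_slope (hW : IsSingleWell f V e) (hd : 0 < d)
    (hf : Tendsto (fun x => f x / x) atTop atTop) :
    ∃ a > 0, a ∉ escapingSlopes d f ∧ a ∉ trappedSlopes d f V ∧
      Ioi a ⊆ escapingSlopes d f ∧ Ioo 0 a ⊆ trappedSlopes d f V := by
  have hwell := hW.toIsOneSidedWell
  have hopenV : IsOpen {z : ℝ × ℝ | energy V z.1 z.2 < 0} :=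
    isOpen_lt (((continuous_snd.pow 2).div_const 2).add
      (hwell.continuous_potential.comp continuous_fst)) continuous_const
  refine exists_threshold
    (isOpen_slopesReaching hwell hd.le (isOpen_lt continuous_fst continuous_const))
    (isOpen_slopesReaching hwell hd.le hopenV)
    (fun α hα => notMem_trappedSlopes_of_mem_escapingSlopes hwell hd.le hα)
    (exists_Ioo_subset_trappedSlopes hW hd) (exists_mem_escapingSlopes hW hd.le hf)
    fun α hα β hβ hα₁ hα₂ hβ₁ hβ₂ => ?_
  obtain ⟨x, y, h⟩ := exists_isTrajectory (d := d) hwell hd.le α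
  obtain ⟨x', y', h'⟩ := exists_isTrajectory (d := d) hwell hd.le β
  exact (h.isFastTrajectory hwell hα hα₁ hα₂).slope_eq hW hd (h'.isFastTrajectory hwell hβ hβ₁ hβ₂)

end PhaseCurve

/-! ### The power nonlinearity -/

/-- The force `x ↦ c x ^ p - κ x`, cut off at the origin. -/
noncomputable def powerForce (κ c p x : ℝ) : ℝ := c * (max x 0) ^ p - κ * max x 0

/-- The potential of `powerForce`. -/
noncomputable def powerPotential (κ c p x : ℝ) : ℝ :=
  c / (p + 1) * (max x 0) ^ (p + 1) - κ / 2 * (max x 0) ^ (2 : ℝ)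

section PowerForce

variable {κ c p x : ℝ}

lemma powerForce_of_pos (hx : 0 < x) : powerForce κ c p x = (c * x ^ (p - 1) - κ) * x := by
  rw [powerForce, max_eq_left hx.le, Real.rpow_sub_one hx.ne']
  field_simp

lemma powerPotential_of_pos (hx : 0 < x) :
    powerPotential κ c p x = (c / (p + 1) * x ^ (p - 1) - κ / 2) * x ^ 2 := by
  have hpow : x ^ (p + 1) = x ^ (p - 1) * x ^ 2 := by
    rw [← Real.rpow_natCast, ← Real.rpow_add hx]
    norm_num
    ring_nf
  rw [powerPotential, max_eq_left hx.le, hpow, Real.rpow_two]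
  ring

lemma hasDerivAt_powerPotential (hp : 1 < p) (x : ℝ) :
    HasDerivAt (powerPotential κ c p) (powerForce κ c p x) x := by
  refine (((hasDerivAt_max_zero_rpow (q := p + 1) (by linarith) x).const_mul (c / (p + 1))).sub
    ((hasDerivAt_max_zero_rpow one_lt_two x).const_mul (κ / 2))).congr_deriv ?_
  have hp1 : p + 1 ≠ 0 := by linarith
  norm_num [powerForce]
  field_simp

lemma locallyLipschitz_powerForce (hp : 1 < p) : LocallyLipschitz (powerForce κ c p) :=
  ((lipschitzWith_smul c).locallyLipschitz.comp (locallyLipschitz_max_zero_rpow hp)).sub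
    (((lipschitzWith_smul κ).comp (LipschitzWith.id.max_const 0)).locallyLipschitz)

lemma tendsto_powerPotential_atTop (hc : 0 < c) (hp : 1 < p) :
    Tendsto (powerPotential κ c p) atTop atTop := by
  have hcoef : Tendsto (fun x : ℝ => c / (p + 1) * x ^ (p - 1) - κ / 2) atTop atTop :=
    tendsto_atTop_add_const_right _ _
      ((tendsto_rpow_atTop (sub_pos.2 hp)).const_mul_atTop (div_pos hc (by linarith)))
  refine (hcoef.atTop_mul_atTop₀ (tendsto_pow_atTop two_ne_zero)).congr' ?_
  filter_upwards [eventually_gt_atTop 0] with x hx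
  exact (powerPotential_of_pos hx).symm

lemma tendsto_powerForce_div_atTop (hc : 0 < c) (hp : 1 < p) :
    Tendsto (fun x => powerForce κ c p x / x) atTop atTop := by
  have hcoef : Tendsto (fun x : ℝ => c * x ^ (p - 1) - κ) atTop atTop :=
    tendsto_atTop_add_const_right _ _
      ((tendsto_rpow_atTop (sub_pos.2 hp)).const_mul_atTop hc)
  refine hcoef.congr' ?_
  filter_upwards [eventually_gt_atTop 0] with x hx
  rw [powerForce_of_pos hx, mul_div_cancel_right₀ _ hx.ne']

lemma isSingleWell_powerForce (hκ : 0 < κ) (hc : 0 < c) (hp : 1 < p) :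
    IsSingleWell (powerForce κ c p) (powerPotential κ c p) ((κ / c) ^ (p - 1)⁻¹) where
  locallyLipschitz := locallyLipschitz_powerForce hp
  hasDerivAt := hasDerivAt_powerPotential hp
  force_of_nonpos x hx := by
    simp [powerForce, max_eq_right hx, Real.zero_rpow (by linarith : p ≠ 0)]
  potential_zero := by simp [powerPotential, Real.zero_rpow (by linarith : p + 1 ≠ 0)]
  tendsto_atTop := tendsto_powerPotential_atTop hc hp
  equilibrium_pos := by positivity
  force_neg x hx := by
    have hlt := (Real.lt_rpow_inv_iff_of_pos hx.1.le (div_pos hκ hc).le (sub_pos.2 hp)).1 hx.2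
    rw [lt_div_iff₀' hc] at hlt
    rw [powerForce_of_pos hx.1]
    exact mul_neg_of_neg_of_pos (sub_neg.2 hlt) hx.1
  force_pos x hx := by
    have hx0 : 0 < x := (Real.rpow_pos_of_pos (div_pos hκ hc) _).trans hx
    have hlt := (Real.rpow_inv_lt_iff_of_pos (div_pos hκ hc).le hx0.le (sub_pos.2 hp)).1 hx
    rw [div_lt_iff₀' hc] at hlt
    rw [powerForce_of_pos hx0]
    exact mul_pos (sub_pos.2 hlt) hx0

end PowerForce

namespace IsDescentOn

variable {m k c p S t : ℝ} {x y : ℝ → ℝ}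

/-- The linearization at the origin has the eigenvalues `m` and `-k`, and `y + k x` is the
coordinate along the unstable direction. -/
lemma hasDerivWithinAt_add_mul (h : IsDescentOn (k - m) (powerForce (m * k) c p) S x y)
    (ht : t ∈ Ici S) : HasDerivWithinAt (fun t => y t + k * x t)
      (m * (y t + k * x t) - c * x t ^ p) (Ici S) t :=
  ((h.phaseCurve.deriv_y t ht).add ((h.phaseCurve.deriv_x t ht).const_mul k)).congr_deriv <| by
    rw [powerForce, max_eq_left (h.x_pos t ht).le]
    ring

lemma tendsto_add_mul {f : ℝ → ℝ} {d : ℝ} (h : IsDescentOn d f S x y) (k : ℝ) :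
    Tendsto (fun t => y t + k * x t) atTop (𝓝 0) := by
  simpa using h.tendsto_y.add (h.tendsto_x.const_mul k)

lemma add_mul_nonneg (h : IsDescentOn (k - m) (powerForce (m * k) c p) S x y) (hm : 0 < m)
    (hc : 0 ≤ c) (ht : S ≤ t) : 0 ≤ y t + k * x t := by
  refine nonneg_of_deriv_le_mul hm (fun t ht => h.hasDerivWithinAt_add_mul ht) (fun t ht => ?_)
    (h.tendsto_add_mul k) ht
  have hpow := mul_nonneg hc (Real.rpow_nonneg (h.x_pos t ht).le p)
  linarith

lemma add_mul_le (h : IsDescentOn (k - m) (powerForce (m * k) c p) S x y) (hm : 0 < m)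
    (hc : 0 ≤ c) (hp : 0 < p) (ht : S ≤ t) : y t + k * x t ≤ c / m * x t ^ p := by
  have hpow : Tendsto (fun t => c / m * x t ^ p) atTop (𝓝 0) := by
    simpa [Real.zero_rpow hp.ne'] using
      (h.tendsto_x.rpow_const (p := p) (Or.inr hp.le)).const_mul (c / m)
  refine sub_nonneg.1 (nonneg_of_deriv_le_mul hm
    (g := fun t => c / m * x t ^ p - (y t + k * x t)) (fun t ht =>
    (((h.phaseCurve.deriv_x t ht).rpow_const (Or.inl (h.x_pos t ht).ne')).const_mul (c / m)).sub
      (h.hasDerivWithinAt_add_mul ht)) (fun t ht => ?_)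
    (by simpa only [sub_zero] using hpow.sub (h.tendsto_add_mul k)) ht)
  have hneg : c / m * (y t * p * x t ^ (p - 1)) ≤ 0 := mul_nonpos_of_nonneg_of_nonpos
    (by positivity) (mul_nonpos_of_nonpos_of_nonneg
      (mul_nonpos_of_nonpos_of_nonneg (h.y_neg t ht).le hp.le)
      (Real.rpow_nonneg (h.x_pos t ht).le _))
  have hcancel : m * (c / m * x t ^ p) = c * x t ^ p := by field_simp
  linarith

lemma exists_le_neg_mul (h : IsDescentOn (k - m) (powerForce (m * k) c p) S x y) (hm : 0 < m)
    (hk : 0 < k) (hc : 0 ≤ c) (hp : 1 < p) :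
    ∃ T ≥ S, ∀ t ≥ T, y t / x t ≤ -(k / 2) ∧ k + y t / x t ≤ c / m * x t ^ (p - 1) := by
  have hpow : Tendsto (fun t => c / m * x t ^ (p - 1)) atTop (𝓝 0) := by
    simpa [Real.zero_rpow (sub_pos.2 hp).ne'] using
      (h.tendsto_x.rpow_const (p := p - 1) (Or.inr (sub_pos.2 hp).le)).const_mul (c / m)
  obtain ⟨T, hT⟩ := eventually_atTop.1 (hpow.eventually_le_const (half_pos hk))
  refine ⟨max T S, le_max_right _ _, fun t ht => ?_⟩
  have hx := h.x_pos t ((le_max_right _ _).trans ht)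
  have hle := h.add_mul_le hm hc (one_pos.trans hp) ((le_max_right _ _).trans ht)
  have hquot : k + y t / x t ≤ c / m * x t ^ (p - 1) := by
    rw [Real.rpow_sub_one hx.ne', ← mul_div_assoc, le_div_iff₀ hx, add_mul,
      div_mul_cancel₀ _ hx.ne']
    linarith
  exact ⟨by linarith [hT t ((le_max_left _ _).trans ht)], hquot⟩

lemma hasDerivWithinAt_mul_add_log {d : ℝ} {f : ℝ → ℝ} (h : IsDescentOn d f S x y) (k : ℝ)
    (ht : t ∈ Ici S) :
    HasDerivWithinAt (fun t => k * t + Real.log (x t)) (k + y t / x t) (Ici S) t :=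
  (((hasDerivWithinAt_id t _).const_mul k).add
    ((h.phaseCurve.deriv_x t ht).log (h.x_pos t ht).ne')).congr_deriv (by rw [mul_one])

lemma exists_mul_add_log_le (h : IsDescentOn (k - m) (powerForce (m * k) c p) S x y) (hm : 0 < m)
    (hk : 0 < k) (hc : 0 ≤ c) (hp : 1 < p) :
    ∃ T ≥ S, ∃ W, ∀ t ≥ T, k * t + Real.log (x t) ≤ W := by
  obtain ⟨T, hTS, hT⟩ := h.exists_le_neg_mul hm hk hc hp
  have hp1 : 0 < p - 1 := sub_pos.2 hp
  set K := 2 * c / (m * k * (p - 1)) with hK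
  have hanti : AntitoneOn (fun t => k * t + Real.log (x t) + K * x t ^ (p - 1)) (Ici T) :=
    antitoneOn_of_forall_hasDerivWithinAt (convex_Ici T)
      (f' := fun t => k + y t / x t + K * (p - 1) * x t ^ (p - 1) * (y t / x t))
      (fun t ht => by
        have hx := h.x_pos t (hTS.trans ht)
        refine (((h.hasDerivWithinAt_mul_add_log k (hTS.trans ht)).add
          (((h.phaseCurve.deriv_x t (hTS.trans ht)).rpow_const (Or.inl hx.ne')).const_mul K)).mono
            (Ici_subset_Ici.2 hTS)).congr_deriv ?_
        rw [Real.rpow_sub_one hx.ne' (p - 1)]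
        ring)
      fun t ht => by
        have hx := h.x_pos t (hTS.trans ht)
        have hmul := mul_le_mul_of_nonneg_left (hT t ht).1
          (show 0 ≤ K * (p - 1) * x t ^ (p - 1) by positivity)
        have hcancel : K * (p - 1) * x t ^ (p - 1) * -(k / 2) = -(c / m * x t ^ (p - 1)) := by
          rw [hK]
          field_simp
        linarith [(hT t ht).2]
  refine ⟨T, hTS, k * T + Real.log (x T) + K * x T ^ (p - 1), fun t ht => ?_⟩
  have hx := h.x_pos t (hTS.trans ht)
  have hle := hanti self_mem_Ici ht ht
  have hnonneg : 0 ≤ K * x t ^ (p - 1) := by positivity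
  simp only at hle
  linarith

lemma exists_tendsto_exp_mul (h : IsDescentOn (k - m) (powerForce (m * k) c p) S x y)
    (hm : 0 < m) (hk : 0 < k) (hc : 0 ≤ c) (hp : 1 < p) :
    ∃ C > 0, Tendsto (fun t => Real.exp (k * t) * x t) atTop (𝓝 C) := by
  obtain ⟨T, hTS, W, hW⟩ := h.exists_mul_add_log_le hm hk hc hp
  have hmono : MonotoneOn (fun t => k * t + Real.log (x t)) (Ici S) :=
    monotoneOn_of_forall_hasDerivWithinAt (convex_Ici S)
      (fun t ht => h.hasDerivWithinAt_mul_add_log k ht) fun t ht => by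
        have hx := h.x_pos t ht
        have hdiv := div_nonneg (h.add_mul_nonneg hm hc ht) hx.le
        rw [add_div, mul_div_cancel_right₀ _ hx.ne'] at hdiv
        linarith
  obtain ⟨L, hL, -⟩ := exists_tendsto_of_monotoneOn_Ici (hmono.mono (Ici_subset_Ici.2 hTS)) hW
  refine ⟨Real.exp L, Real.exp_pos L, ((Real.continuous_exp.tendsto L).comp hL).congr' ?_⟩
  filter_upwards [eventually_ge_atTop S] with t ht
  rw [Function.comp_apply, Real.exp_add, Real.exp_log (h.x_pos t ht)]

end IsDescentOn

/-! ### The Emden–Fowler change of variables -/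

/-- The exponent of the scaling symmetry `u ↦ μ ^ (2 / (p - 1)) u(μ ·)` of the radial equation. -/
noncomputable def scalingExp (p : ℝ) : ℝ := 2 / (p - 1)

/-- With `m = scalingExp p`, the exponent `k` for which `x(t) = r ^ m u(r)`, `r = exp t`, behaves
like `exp (-k t)` when `u` behaves like the fundamental solution `r ^ (2 - ν)`. -/
noncomputable def fastExp (ν p : ℝ) : ℝ := ν - 2 - scalingExp p

/-- The damping of the radial equation in the variables `x(t) = r ^ m u(r)`, `r = exp t`. -/
noncomputable def emdenFowlerDamping (ν p : ℝ) : ℝ := fastExp ν p - scalingExp p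

/-- The force of the radial equation in the variables `x(t) = r ^ m u(r)`, `r = exp t`. -/
noncomputable def emdenFowlerForce (ν p lam : ℝ) : ℝ → ℝ :=
  powerForce (scalingExp p * fastExp ν p) lam⁻¹ p

/-- The potential of `emdenFowlerForce`. -/
noncomputable def emdenFowlerPotential (ν p lam : ℝ) : ℝ → ℝ :=
  powerPotential (scalingExp p * fastExp ν p) lam⁻¹ p

/-- The function `u(r) = r ^ (-m) x(log r)` of which `x` is the Emden–Fowler transform. -/
noncomputable def radialProfile (p : ℝ) (x : ℝ → ℝ) (r : ℝ) : ℝ :=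
  r ^ (-scalingExp p) * x (Real.log r)

/-- The derivative of `radialProfile p x` when `y` is the derivative of `x`. -/
noncomputable def radialVelocity (p : ℝ) (x y : ℝ → ℝ) (r : ℝ) : ℝ :=
  r ^ (-scalingExp p - 1) * (y (Real.log r) - scalingExp p * x (Real.log r))

/-- The range of parameters of the theorem, in which the Emden–Fowler damping is positive. -/
structure IsSupercritical (ν p lam : ℝ) : Prop where
  two_lt : 2 < ν
  lam_pos : 0 < lam
  lt_exponent : (ν + 2) / (ν - 2) < p

namespace IsSupercritical

variable {ν p lam : ℝ}

lemma one_lt (hS : IsSupercritical ν p lam) : 1 < p := by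
  refine lt_trans ?_ hS.lt_exponent
  rw [lt_div_iff₀ (sub_pos.2 hS.two_lt)]
  linarith

lemma scalingExp_pos (hS : IsSupercritical ν p lam) : 0 < scalingExp p :=
  div_pos two_pos (sub_pos.2 hS.one_lt)

lemma damping_pos (hS : IsSupercritical ν p lam) : 0 < emdenFowlerDamping ν p := by
  have hν := sub_pos.2 hS.two_lt
  have hlt : scalingExp p < (ν - 2) / 2 := by
    have hp := (div_lt_iff₀ hν).1 hS.lt_exponent
    rw [scalingExp, div_lt_div_iff₀ (sub_pos.2 hS.one_lt) two_pos]
    linarith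
  unfold emdenFowlerDamping fastExp
  linarith

lemma fastExp_pos (hS : IsSupercritical ν p lam) : 0 < fastExp ν p :=
  hS.scalingExp_pos.trans (sub_pos.1 hS.damping_pos)

lemma isSingleWell (hS : IsSupercritical ν p lam) :
    IsSingleWell (emdenFowlerForce ν p lam) (emdenFowlerPotential ν p lam)
      ((scalingExp p * fastExp ν p / lam⁻¹) ^ (p - 1)⁻¹) :=
  isSingleWell_powerForce (mul_pos hS.scalingExp_pos hS.fastExp_pos) (inv_pos.2 hS.lam_pos)
    hS.one_lt

lemma isOneSidedWell (hS : IsSupercritical ν p lam) :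
    IsOneSidedWell (emdenFowlerForce ν p lam) (emdenFowlerPotential ν p lam) :=
  hS.isSingleWell.toIsOneSidedWell

end IsSupercritical

section RadialProfile

variable {ν p lam d r : ℝ} {f u v x y : ℝ → ℝ}

lemma scalingExp_mul (hp : 1 < p) : scalingExp p * p = scalingExp p + 2 := by
  have hcancel : scalingExp p * (p - 1) = 2 := div_mul_cancel₀ _ (sub_pos.2 hp).ne'
  linarith

lemma emdenFowlerForce_of_nonneg {z : ℝ} (hz : 0 ≤ z) :
    emdenFowlerForce ν p lam z = lam⁻¹ * z ^ p - scalingExp p * fastExp ν p * z := by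
  rw [emdenFowlerForce, powerForce, max_eq_left hz]

lemma rpow_mul_radialProfile {q : ℝ} (hr : 0 < r) :
    r ^ q * radialProfile p x r = Real.exp ((q - scalingExp p) * Real.log r) * x (Real.log r) := by
  rw [radialProfile, ← mul_assoc, ← Real.rpow_add hr, Real.rpow_def_of_pos hr, ← sub_eq_add_neg,
    mul_comm (Real.log r)]

lemma hasDerivWithinAt_comp_log {f' : ℝ} (hf : HasDerivWithinAt f f' (Ici 0) (Real.log r))
    (hr : 1 ≤ r) : HasDerivWithinAt (fun r => f (Real.log r)) (f' / r) (Ici 1) r :=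
  hf.comp r (Real.hasDerivAt_log (by linarith)).hasDerivWithinAt fun _ => Real.log_nonneg

lemma hasDerivWithinAt_radialProfile (h : IsPhaseCurveOn d f x y (Ici 0)) (hr : 1 ≤ r) :
    HasDerivWithinAt (radialProfile p x) (radialVelocity p x y r) (Ici 1) r := by
  have hr0 : r ≠ 0 := by linarith
  refine ((Real.hasDerivAt_rpow_const (Or.inl hr0)).hasDerivWithinAt.mul
    (hasDerivWithinAt_comp_log (h.deriv_x _ (Real.log_nonneg hr)) hr)).congr_deriv ?_
  rw [radialVelocity, Real.rpow_sub_one hr0]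
  field_simp
  ring

lemma hasDerivWithinAt_radialVelocity (h : IsPhaseCurveOn d f x y (Ici 0)) (hr : 1 ≤ r) :
    HasDerivWithinAt (radialVelocity p x y)
      (r ^ (-scalingExp p - 1 - 1) * (scalingExp p * (scalingExp p + 1) * x (Real.log r)
        - (d + 2 * scalingExp p + 1) * y (Real.log r) - f (x (Real.log r)))) (Ici 1) r := by
  have hr0 : r ≠ 0 := by linarith
  have hlog := Real.log_nonneg hr
  refine ((Real.hasDerivAt_rpow_const (Or.inl hr0)).hasDerivWithinAt.mul
    ((hasDerivWithinAt_comp_log (h.deriv_y _ hlog) hr).sub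
      ((hasDerivWithinAt_comp_log (h.deriv_x _ hlog) hr).const_mul (scalingExp p)))).congr_deriv ?_
  rw [Real.rpow_sub_one hr0 (-scalingExp p - 1)]
  simp only [Pi.sub_apply]
  field_simp
  ring

lemma radialProfile_rpow (hp : 1 < p) (hr : 0 < r) (hx : 0 ≤ x (Real.log r)) :
    radialProfile p x r ^ p = r ^ (-scalingExp p - 1 - 1) * x (Real.log r) ^ p := by
  rw [radialProfile, Real.mul_rpow (by positivity) hx, ← Real.rpow_mul hr.le, neg_mul,
    scalingExp_mul hp]
  ring_nf

lemma isPositiveSolution_radialProfile (hp : 1 < p) {α : ℝ}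
    (h : IsTrajectory (emdenFowlerDamping ν p) (emdenFowlerForce ν p lam) α x y) {ρ : EReal}
    (hρ : 1 < ρ) (hpos : ∀ r : ℝ, 1 < r → (r : EReal) < ρ → 0 < x (Real.log r)) :
    IsPositiveSolution ν p lam α ρ (radialProfile p x) where
  one_lt := hρ
  pos r hr hrρ := mul_pos (Real.rpow_pos_of_pos (one_pos.trans hr) _) (hpos r hr hrρ)
  initial := by simp [radialProfile, h.x_zero]
  ode := by
    refine ⟨radialVelocity p x y, fun r hr _ => hasDerivWithinAt_radialProfile h.phaseCurve hr,
      by simp [radialVelocity, h.x_zero, h.y_zero],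
      (hasDerivWithinAt_radialVelocity h.phaseCurve le_rfl).continuousWithinAt,
      fun r hr hrρ => ⟨_, (hasDerivWithinAt_radialVelocity h.phaseCurve hr.le).hasDerivAt
        (Ici_mem_nhds hr), ?_⟩⟩
    have hx := hpos r hr hrρ
    have hr0 : 0 < r := one_pos.trans hr
    rw [radialProfile_rpow hp hr0 hx.le, emdenFowlerForce_of_nonneg hx.le, radialVelocity,
      Real.rpow_sub_one hr0.ne' (-scalingExp p - 1), emdenFowlerDamping, fastExp]
    ring

lemma isPhaseCurveOn_of_radial (hp : 1 < p) {R : ℝ} (hR : 0 < R)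
    (hu0 : ∀ r ∈ Icc 1 R, 0 ≤ u r) (hu : ∀ r ∈ Icc 1 R, HasDerivWithinAt u (v r) (Icc 1 R) r)
    (hv : ∀ r ∈ Icc 1 R,
      HasDerivWithinAt v (-(u r ^ p / lam) - (ν - 1) * (v r / r)) (Icc 1 R) r) :
    IsPhaseCurveOn (emdenFowlerDamping ν p) (emdenFowlerForce ν p lam)
      (fun t => Real.exp (scalingExp p * t) * u (Real.exp t))
      (fun t => Real.exp (scalingExp p * t) *
        (scalingExp p * u (Real.exp t) + Real.exp t * v (Real.exp t))) (Icc 0 (Real.log R)) := by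
  set m := scalingExp p
  have hmaps : MapsTo Real.exp (Icc 0 (Real.log R)) (Icc 1 R) := fun t ht =>
    ⟨Real.one_le_exp ht.1, (Real.le_log_iff_exp_le hR).1 ht.2⟩
  have hexp (t : ℝ) := (Real.hasDerivAt_exp t).hasDerivWithinAt (s := Icc 0 (Real.log R))
  have hexpm (t : ℝ) := ((hasDerivAt_id t).const_mul m).exp.hasDerivWithinAt
    (s := Icc 0 (Real.log R))
  have hu' : ∀ t ∈ Icc 0 (Real.log R), HasDerivWithinAt (fun t => u (Real.exp t)) _ _ t :=
    fun t ht => (hu _ (hmaps ht)).comp t (hexp t) hmaps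
  have hv' : ∀ t ∈ Icc 0 (Real.log R), HasDerivWithinAt (fun t => v (Real.exp t)) _ _ t :=
    fun t ht => (hv _ (hmaps ht)).comp t (hexp t) hmaps
  refine ⟨fun t ht => ((hexpm t).mul (hu' t ht)).congr_deriv (by simp only [id]; ring),
    fun t ht => ((hexpm t).mul
      (((hu' t ht).const_mul m).add ((hexp t).mul (hv' t ht)))).congr_deriv ?_⟩
  have hut := hu0 _ (hmaps ht)
  have hpow : (Real.exp (m * t) * u (Real.exp t)) ^ p =
      Real.exp (m * t) * Real.exp t ^ 2 * u (Real.exp t) ^ p := by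
    rw [Real.mul_rpow (Real.exp_pos _).le hut, ← Real.exp_mul, ← Real.exp_nat_mul, ← Real.exp_add]
    congr 2
    push_cast
    linear_combination t * scalingExp_mul hp
  have hne := (Real.exp_pos t).ne'
  rw [emdenFowlerForce_of_nonneg (by positivity), hpow, emdenFowlerDamping, fastExp]
  simp only [id, Pi.add_apply, Pi.mul_apply]
  field_simp
  ring

end RadialProfile

namespace IsPositiveSolution

variable {ν p lam α r : ℝ} {ρ : EReal} {u x y : ℝ → ℝ}

lemma exists_hasDerivWithinAt (hp : 0 ≤ p) (hu : IsPositiveSolution ν p lam α ρ u) :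
    ∃ v : ℝ → ℝ, v 1 = α ∧ ∀ r : ℝ, 1 ≤ r → (r : EReal) < ρ →
      HasDerivWithinAt u (v r) (Ici 1) r ∧
      HasDerivWithinAt v (-(u r ^ p / lam) - (ν - 1) * (v r / r)) (Ici 1) r := by
  obtain ⟨v, hderiv, hv1, hvcont, hode⟩ := hu.ode
  have hv : ∀ r : ℝ, 1 < r → (r : EReal) < ρ →
      HasDerivAt v (-(u r ^ p / lam) - (ν - 1) * (v r / r)) r := fun r hr hrρ => by
    obtain ⟨w, hw, heq⟩ := hode r hr hrρ
    exact hw.congr_deriv (by linarith)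
  refine ⟨v, hv1, fun r hr hrρ => ⟨hderiv r hr hrρ, ?_⟩⟩
  rcases hr.eq_or_lt with rfl | hr
  · refine hasDerivWithinAt_Ici_of_eventually_hasDerivAt
      (g := fun r => -(u r ^ p / lam) - (ν - 1) * (v r / r)) hvcont ?_ ?_
    · exact (((hderiv 1 le_rfl hrρ).continuousWithinAt.rpow_const (Or.inr hp)).div_const
        lam).neg.sub ((hvcont.div continuousWithinAt_id one_ne_zero).const_mul _)
    · have hρ : ∀ᶠ r : ℝ in 𝓝 1, (r : EReal) < ρ :=
        continuous_coe_real_ereal.continuousAt.eventually_lt_const hrρ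
      filter_upwards [self_mem_nhdsWithin, nhdsWithin_le_nhds hρ] with r hr hrρ
      exact hv r hr hrρ
  · exact (hv r hr hrρ).hasDerivWithinAt

lemma nonneg (hu : IsPositiveSolution ν p lam α ρ u) (hr : 1 ≤ r) (hrρ : (r : EReal) < ρ) :
    0 ≤ u r := by
  rcases hr.eq_or_lt with rfl | hr
  exacts [hu.initial.ge, (hu.pos r hr hrρ).le]

lemma eq_radialProfile (hp : 1 < p)
    (h : IsTrajectory (emdenFowlerDamping ν p) (emdenFowlerForce ν p lam) α x y)
    (hu : IsPositiveSolution ν p lam α ρ u) (hr : 1 ≤ r) (hrρ : (r : EReal) < ρ) :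
    u r = radialProfile p x r := by
  obtain ⟨v, hv1, hderiv⟩ := hu.exists_hasDerivWithinAt (zero_le_one.trans hp.le)
  have hr0 : 0 < r := one_pos.trans_le hr
  have hlog := Real.log_nonneg hr
  have hρ : ∀ s ∈ Icc 1 r, (s : EReal) < ρ := fun s hs => (EReal.coe_le_coe_iff.2 hs.2).trans_lt hrρ
  have hcurve := isPhaseCurveOn_of_radial hp hr0 (fun s hs => hu.nonneg hs.1 (hρ s hs))
    (fun s hs => (hderiv s hs.1 (hρ s hs)).1.mono Icc_subset_Ici_self)
    (fun s hs => (hderiv s hs.1 (hρ s hs)).2.mono Icc_subset_Ici_self)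
  have heq := (hcurve.eqOn (locallyLipschitz_powerForce hp) ordConnected_Icc
    (h.phaseCurve.mono Icc_subset_Ici_self) (left_mem_Icc.2 hlog) (by simp [hu.initial, h.x_zero])
    (by simp [hu.initial, hv1, h.y_zero]) (right_mem_Icc.2 hlog)).1
  rw [radialProfile, ← heq, Real.exp_log hr0, mul_comm (scalingExp p), ← Real.rpow_def_of_pos hr0,
    ← mul_assoc, ← Real.rpow_add hr0, neg_add_cancel, Real.rpow_zero, one_mul]

end IsPositiveSolution

/-! ### The critical slope -/

section MaximalSolution

variable {ν p lam α : ℝ} {ρ : EReal} {u x y : ℝ → ℝ}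

lemma IsSupercritical.exists_isTrajectory (hS : IsSupercritical ν p lam) (α : ℝ) :
    ∃ x y, IsTrajectory (emdenFowlerDamping ν p) (emdenFowlerForce ν p lam) α x y :=
  _root_.exists_isTrajectory hS.isOneSidedWell hS.damping_pos.le α

lemma IsMaximalPositiveSolution.unique {ρ₁ ρ₂ : EReal} {u₁ u₂ : ℝ → ℝ}
    (hS : IsSupercritical ν p lam) (h₁ : IsMaximalPositiveSolution ν p lam α ρ₁ u₁)
    (h₂ : IsMaximalPositiveSolution ν p lam α ρ₂ u₂) :
    ρ₁ = ρ₂ ∧ ∀ r : ℝ, 1 ≤ r → (r : EReal) < ρ₁ → u₁ r = u₂ r := by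
  obtain ⟨x, y, h⟩ := hS.exists_isTrajectory α
  have hagree : ∀ r : ℝ, 1 ≤ r → (r : EReal) < ρ₁ → (r : EReal) < ρ₂ → u₁ r = u₂ r :=
    fun r hr hr₁ hr₂ => (h₁.sol.eq_radialProfile hS.one_lt h hr hr₁).trans
      (h₂.sol.eq_radialProfile hS.one_lt h hr hr₂).symm
  have hρ : ρ₁ = ρ₂ := by
    rcases le_total ρ₁ ρ₂ with hle | hle
    · exact (h₁.maximal ρ₂ u₂ h₂.sol hle
        fun r hr hlt => (hagree r hr hlt (hlt.trans_le hle)).symm).symm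
    · exact h₂.maximal ρ₁ u₁ h₁.sol hle fun r hr hlt => hagree r hr (hlt.trans_le hle) hlt
  exact ⟨hρ, fun r hr hlt => hagree r hr hlt (hρ ▸ hlt)⟩

lemma isMaximalPositiveSolution_top (hp : 1 < p)
    (h : IsTrajectory (emdenFowlerDamping ν p) (emdenFowlerForce ν p lam) α x y)
    (hx : ∀ t > 0, 0 < x t) : IsMaximalPositiveSolution ν p lam α ⊤ (radialProfile p x) where
  sol := isPositiveSolution_radialProfile hp h (EReal.coe_lt_top 1)
    fun _ hr _ => hx _ (Real.log_pos hr)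
  maximal _ _ _ hle _ := top_le_iff.1 hle

lemma isMaximalPositiveSolution_exp (hp : 1 < p)
    (h : IsTrajectory (emdenFowlerDamping ν p) (emdenFowlerForce ν p lam) α x y) {s : ℝ}
    (hs : 0 < s) (hxs : x s = 0) (hx : ∀ t ∈ Ioo 0 s, 0 < x t) :
    IsMaximalPositiveSolution ν p lam α (Real.exp s : ℝ) (radialProfile p x) where
  sol := isPositiveSolution_radialProfile hp h (EReal.coe_lt_coe (Real.one_lt_exp_iff.2 hs))
    fun r hr hrs => hx _ ⟨Real.log_pos hr,
      (Real.log_lt_iff_lt_exp (one_pos.trans hr)).2 (EReal.coe_lt_coe_iff.1 hrs)⟩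
  maximal ρ' w hw hle _ := by
    by_contra hne
    have hlt := hle.lt_of_ne' hne
    have hexp := Real.one_lt_exp_iff.2 hs
    refine (hw.pos _ hexp hlt).ne' ?_
    rw [hw.eq_radialProfile hp h hexp.le hlt, radialProfile, Real.log_exp, hxs, mul_zero]

lemma tendsto_radialProfile_nhdsLT {d s : ℝ} {f : ℝ → ℝ} (h : IsTrajectory d f α x y) (hs : 0 < s)
    (hxs : x s = 0) : Tendsto (radialProfile p x) (𝓝[<] Real.exp s) (𝓝 0) := by
  have hcont := ((hasDerivWithinAt_radialProfile (p := p) h.phaseCurve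
    (Real.one_le_exp hs.le)).hasDerivAt (Ici_mem_nhds (Real.one_lt_exp_iff.2 hs))).continuousAt
  have hzero : radialProfile p x (Real.exp s) = 0 := by
    rw [radialProfile, Real.log_exp, hxs, mul_zero]
  simpa only [hzero] using hcont.tendsto.mono_left nhdsWithin_le_nhds

lemma exists_isMaximalPositiveSolution_of_mem_escapingSlopes (hS : IsSupercritical ν p lam)
    (hα : 0 < α)
    (hescape : α ∈ escapingSlopes (emdenFowlerDamping ν p) (emdenFowlerForce ν p lam)) :
    ∃ R > 1, ∃ u, IsMaximalPositiveSolution ν p lam α (R : ℝ) u ∧ Tendsto u (𝓝[<] R) (𝓝 0) := by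
  obtain ⟨x, y, h, t, ht, hxt⟩ := hescape
  rcases h.pos_or_crosses hS.isOneSidedWell hα with hpos | ⟨s, hs, hxs, hpos, -⟩
  · rcases ht.eq_or_lt with rfl | ht
    exacts [absurd h.x_zero (ne_of_lt hxt), absurd hxt (hpos t ht).not_gt]
  · exact ⟨Real.exp s, Real.one_lt_exp_iff.2 hs, radialProfile p x,
      isMaximalPositiveSolution_exp hS.one_lt h hs hxs hpos, tendsto_radialProfile_nhdsLT h hs hxs⟩

lemma exists_isMaximalPositiveSolution (hS : IsSupercritical ν p lam) (hα : 0 < α) :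
    ∃ (ρ : EReal) (u : ℝ → ℝ), IsMaximalPositiveSolution ν p lam α ρ u := by
  by_cases hescape : α ∈ escapingSlopes (emdenFowlerDamping ν p) (emdenFowlerForce ν p lam)
  · obtain ⟨R, -, u, hu, -⟩ := exists_isMaximalPositiveSolution_of_mem_escapingSlopes hS hα hescape
    exact ⟨R, u, hu⟩
  · obtain ⟨x, y, h⟩ := hS.exists_isTrajectory α
    exact ⟨⊤, _, isMaximalPositiveSolution_top hS.one_lt h
      (h.pos_of_notMem_escapingSlopes hS.isOneSidedWell hα hescape)⟩

namespace IsMaximalPositiveSolution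

lemma exists_eq_coe (hS : IsSupercritical ν p lam) (hα : 0 < α)
    (hescape : α ∈ escapingSlopes (emdenFowlerDamping ν p) (emdenFowlerForce ν p lam))
    (hu : IsMaximalPositiveSolution ν p lam α ρ u) :
    ∃ R : ℝ, ρ = R ∧ Tendsto u (𝓝[<] R) (𝓝 0) := by
  obtain ⟨R, hR, w, hw, hlim⟩ :=
    exists_isMaximalPositiveSolution_of_mem_escapingSlopes hS hα hescape
  obtain ⟨hρ, heq⟩ := hw.unique hS hu
  refine ⟨R, hρ.symm, hlim.congr' ?_⟩
  filter_upwards [Ioo_mem_nhdsLT hR] with r hr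
  exact heq r hr.1.le (EReal.coe_lt_coe hr.2)

lemma eq_top (hS : IsSupercritical ν p lam) (hα : 0 < α)
    (hescape : α ∉ escapingSlopes (emdenFowlerDamping ν p) (emdenFowlerForce ν p lam))
    (hu : IsMaximalPositiveSolution ν p lam α ρ u) : ρ = ⊤ := by
  obtain ⟨x, y, h⟩ := hS.exists_isTrajectory α
  exact (hu.unique hS (isMaximalPositiveSolution_top hS.one_lt h
    (h.pos_of_notMem_escapingSlopes hS.isOneSidedWell hα hescape))).1

lemma rpow_mul_eventuallyEq (hp : 1 < p)
    (h : IsTrajectory (emdenFowlerDamping ν p) (emdenFowlerForce ν p lam) α x y)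
    (hu : IsMaximalPositiveSolution ν p lam α ⊤ u) (q : ℝ) :
    (fun t => Real.exp ((q - scalingExp p) * t) * x t) ∘ Real.log =ᶠ[atTop]
      fun r => r ^ q * u r := by
  filter_upwards [eventually_ge_atTop 1] with r hr
  rw [hu.sol.eq_radialProfile hp h hr (EReal.coe_lt_top r),
    rpow_mul_radialProfile (one_pos.trans_le hr), Function.comp_apply]

lemma tendsto_slow (hS : IsSupercritical ν p lam) (hα : 0 < α)
    (htrapped : α ∈ trappedSlopes (emdenFowlerDamping ν p) (emdenFowlerForce ν p lam)
      (emdenFowlerPotential ν p lam)) (hu : IsMaximalPositiveSolution ν p lam α ⊤ u) :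
    Tendsto (fun r => r ^ scalingExp p * u r) atTop
      (𝓝 ((scalingExp p * fastExp ν p / lam⁻¹) ^ (p - 1)⁻¹)) := by
  obtain ⟨x, y, h, t, ht, hE⟩ := id htrapped
  have hpos := h.pos_of_energy_neg hS.isOneSidedWell hS.damping_pos.le hα ht hE
  refine Tendsto.congr' (hu.rpow_mul_eventuallyEq hS.one_lt h _)
    (Tendsto.comp ?_ Real.tendsto_log_atTop)
  simpa using h.tendsto_equilibrium hS.isSingleWell hS.damping_pos hpos ht hE

lemma exists_tendsto_fast (hS : IsSupercritical ν p lam) (hα : 0 < α)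
    (hescape : α ∉ escapingSlopes (emdenFowlerDamping ν p) (emdenFowlerForce ν p lam))
    (htrapped : α ∉ trappedSlopes (emdenFowlerDamping ν p) (emdenFowlerForce ν p lam)
      (emdenFowlerPotential ν p lam)) (hu : IsMaximalPositiveSolution ν p lam α ⊤ u) :
    ∃ C : ℝ, 0 < C ∧ Tendsto (fun r => r ^ (ν - 2) * u r) atTop (𝓝 C) := by
  obtain ⟨x, y, h⟩ := hS.exists_isTrajectory α
  obtain ⟨S, -, hdescent⟩ := (h.isFastTrajectory hS.isOneSidedWell hα hescape
    htrapped).exists_isDescentOn hS.isSingleWell hS.damping_pos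
  obtain ⟨C, hC, hlim⟩ := hdescent.exists_tendsto_exp_mul hS.scalingExp_pos hS.fastExp_pos
    (inv_pos.2 hS.lam_pos).le hS.one_lt
  exact ⟨C, hC, (hlim.comp Real.tendsto_log_atTop).congr'
    (hu.rpow_mul_eventuallyEq hS.one_lt h (ν - 2))⟩

end IsMaximalPositiveSolution

end MaximalSolution

namespace IsSupercritical

variable {ν p lam α : ℝ}

lemma mem_crossingSlopes_iff (hS : IsSupercritical ν p lam) : α ∈ crossingSlopes ν p lam ↔
    0 < α ∧ α ∈ escapingSlopes (emdenFowlerDamping ν p) (emdenFowlerForce ν p lam) := by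
  refine and_congr_right fun hα => ⟨fun ⟨ρ, u, hu, hρ⟩ => ?_, fun hescape => ?_⟩
  · by_contra hescape
    exact hρ.ne (hu.eq_top hS hα hescape)
  · obtain ⟨R, -, u, hu, -⟩ := exists_isMaximalPositiveSolution_of_mem_escapingSlopes hS hα hescape
    exact ⟨R, u, hu, EReal.coe_lt_top R⟩

lemma criticalSlope_separates (hS : IsSupercritical ν p lam) :
    0 < criticalSlope ν p lam ∧
    criticalSlope ν p lam ∉ escapingSlopes (emdenFowlerDamping ν p) (emdenFowlerForce ν p lam) ∧
    criticalSlope ν p lam ∉ trappedSlopes (emdenFowlerDamping ν p) (emdenFowlerForce ν p lam)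
      (emdenFowlerPotential ν p lam) ∧
    Ioi (criticalSlope ν p lam) ⊆
      escapingSlopes (emdenFowlerDamping ν p) (emdenFowlerForce ν p lam) ∧
    Ioo 0 (criticalSlope ν p lam) ⊆ trappedSlopes (emdenFowlerDamping ν p)
      (emdenFowlerForce ν p lam) (emdenFowlerPotential ν p lam) := by
  obtain ⟨a, ha, hescape, htrapped, habove, hbelow⟩ := exists_separating_slope hS.isSingleWell
    hS.damping_pos (tendsto_powerForce_div_atTop (inv_pos.2 hS.lam_pos) hS.one_lt)
  have hcrossing : crossingSlopes ν p lam = Ioi a := by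
    ext α
    rw [hS.mem_crossingSlopes_iff]
    refine ⟨fun ⟨hα, hαesc⟩ => ?_, fun hα => ⟨ha.trans hα, habove hα⟩⟩
    refine mem_Ioi.2 (lt_of_not_ge fun hle => ?_)
    rcases hle.eq_or_lt with rfl | hlt
    · exact hescape hαesc
    · exact notMem_trappedSlopes_of_mem_escapingSlopes hS.isOneSidedWell hS.damping_pos.le hα hαesc
        (hbelow ⟨hα, hlt⟩)
  have hcrit : criticalSlope ν p lam = a := by rw [criticalSlope, hcrossing, csInf_Ioi]
  rw [hcrit]
  exact ⟨ha, hescape, htrapped, habove, hbelow⟩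

lemma criticalSlope_pos (hS : IsSupercritical ν p lam) : 0 < criticalSlope ν p lam :=
  hS.criticalSlope_separates.1

lemma crossingSlopes_nonempty (hS : IsSupercritical ν p lam) :
    (crossingSlopes ν p lam).Nonempty := by
  obtain ⟨hpos, -, -, habove, -⟩ := hS.criticalSlope_separates
  have hlt := lt_add_one (criticalSlope ν p lam)
  exact ⟨_, hS.mem_crossingSlopes_iff.2 ⟨hpos.trans hlt, habove hlt⟩⟩

end IsSupercritical

namespace IsMaximalPositiveSolution

variable {ν p lam α : ℝ} {ρ : EReal} {u : ℝ → ℝ}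

lemma of_criticalSlope_lt (hS : IsSupercritical ν p lam) (hα : criticalSlope ν p lam < α)
    (hu : IsMaximalPositiveSolution ν p lam α ρ u) :
    ∃ R : ℝ, ρ = R ∧ Tendsto u (𝓝[<] R) (𝓝 0) :=
  hu.exists_eq_coe hS (hS.criticalSlope_pos.trans hα) (hS.criticalSlope_separates.2.2.2.1 hα)

lemma of_eq_criticalSlope (hS : IsSupercritical ν p lam)
    (hu : IsMaximalPositiveSolution ν p lam (criticalSlope ν p lam) ρ u) :
    ρ = ⊤ ∧ ∃ C : ℝ, 0 < C ∧ Tendsto (fun r => r ^ (ν - 2) * u r) atTop (𝓝 C) := by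
  obtain ⟨hpos, hescape, htrapped, -⟩ := hS.criticalSlope_separates
  obtain rfl := hu.eq_top hS hpos hescape
  exact ⟨rfl, hu.exists_tendsto_fast hS hpos hescape htrapped⟩

lemma of_lt_criticalSlope (hS : IsSupercritical ν p lam) (hα : 0 < α)
    (hlt : α < criticalSlope ν p lam) (hu : IsMaximalPositiveSolution ν p lam α ρ u) :
    ρ = ⊤ ∧ Tendsto (fun r => r ^ scalingExp p * u r) atTop
      (𝓝 ((scalingExp p * fastExp ν p / lam⁻¹) ^ (p - 1)⁻¹)) := by
  have htrapped := hS.criticalSlope_separates.2.2.2.2 ⟨hα, hlt⟩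
  obtain rfl := hu.eq_top hS hα fun hescape => notMem_trappedSlopes_of_mem_escapingSlopes
    hS.isOneSidedWell hS.damping_pos.le hα hescape htrapped
  exact ⟨rfl, hu.tendsto_slow hS hα htrapped⟩

lemma eq_criticalSlope_of_fast (hS : IsSupercritical ν p lam) (hα : 0 < α)
    (hu : IsMaximalPositiveSolution ν p lam α ⊤ u) {C : ℝ}
    (hfast : Tendsto (fun r => r ^ (ν - 2) * u r) atTop (𝓝 C)) : α = criticalSlope ν p lam := by
  rcases lt_trichotomy α (criticalSlope ν p lam) with hlt | heq | hgt
  · have hzero : Tendsto (fun r => r ^ scalingExp p * u r) atTop (𝓝 0) := by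
      have hprod := (tendsto_rpow_neg_atTop hS.fastExp_pos).mul hfast
      rw [zero_mul] at hprod
      refine hprod.congr' ?_
      filter_upwards [eventually_gt_atTop 0] with r hr
      rw [← mul_assoc, ← Real.rpow_add hr, fastExp, neg_sub, sub_add_cancel]
    exact absurd (tendsto_nhds_unique hzero (hu.of_lt_criticalSlope hS hα hlt).2)
      hS.isSingleWell.equilibrium_pos.ne
  · exact heq
  · obtain ⟨R, hR, -⟩ := hu.of_criticalSlope_lt hS hgt
    exact absurd hR (EReal.coe_ne_top R).symm

end IsMaximalPositiveSolution

lemma scalingExp_mul_fastExp_div {ν p lam : ℝ} (hp : p ≠ 1) :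
    scalingExp p * fastExp ν p / lam⁻¹ = 2 * lam * ((ν - 2) * p - ν) / (p - 1) ^ 2 := by
  have hp1 := sub_ne_zero.2 hp
  unfold fastExp scalingExp
  field_simp
  ring

theorem proposition6p2 (ν p lam : ℝ) (hν : 2 < ν) (hlam : 0 < lam)
    (hp : (ν + 2) / (ν - 2) < p) :
    -- for each slope the maximal positive solution exists and is unique
    (∀ α : ℝ, 0 < α →
      (∃ (ρ : EReal) (u : ℝ → ℝ), IsMaximalPositiveSolution ν p lam α ρ u) ∧
      ∀ (ρ₁ ρ₂ : EReal) (u₁ u₂ : ℝ → ℝ), IsMaximalPositiveSolution ν p lam α ρ₁ u₁ →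
        IsMaximalPositiveSolution ν p lam α ρ₂ u₂ →
        ρ₁ = ρ₂ ∧ ∀ r : ℝ, 1 ≤ r → (r : EReal) < ρ₁ → u₁ r = u₂ r) ∧
    -- the infimum that defines the critical slope is over a nonempty set
    (crossingSlopes ν p lam).Nonempty ∧
    -- (i)
    0 < criticalSlope ν p lam ∧
    -- (ii)
    (∀ α : ℝ, criticalSlope ν p lam < α → ∀ (ρ : EReal) (u : ℝ → ℝ),
      IsMaximalPositiveSolution ν p lam α ρ u →
        ∃ R : ℝ, ρ = (R : EReal) ∧ Tendsto u (𝓝[<] R) (𝓝 0)) ∧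
    -- (iii)
    (∀ (ρ : EReal) (u : ℝ → ℝ),
      IsMaximalPositiveSolution ν p lam (criticalSlope ν p lam) ρ u →
        ρ = ⊤ ∧ ∃ C : ℝ, 0 < C ∧ Tendsto (fun r : ℝ => r ^ (ν - 2) * u r) atTop (𝓝 C)) ∧
    -- uniqueness of the fast decaying solution
    (∀ α : ℝ, 0 < α → ∀ u : ℝ → ℝ, IsMaximalPositiveSolution ν p lam α ⊤ u →
      (∃ C : ℝ, 0 < C ∧ Tendsto (fun r : ℝ => r ^ (ν - 2) * u r) atTop (𝓝 C)) →
        α = criticalSlope ν p lam) ∧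
    -- (iv)
    (∀ α : ℝ, 0 < α → α < criticalSlope ν p lam → ∀ (ρ : EReal) (u : ℝ → ℝ),
      IsMaximalPositiveSolution ν p lam α ρ u →
        ρ = ⊤ ∧ Tendsto (fun r : ℝ => r ^ (2 / (p - 1)) * u r) atTop
          (𝓝 ((2 * lam * ((ν - 2) * p - ν) / (p - 1) ^ 2) ^ (1 / (p - 1))))) := by
  have hS : IsSupercritical ν p lam := ⟨hν, hlam, hp⟩
  rw [← scalingExp_mul_fastExp_div hS.one_lt.ne', one_div]
  exact ⟨fun α hα => ⟨exists_isMaximalPositiveSolution hS hα,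
      fun _ _ _ _ hu₁ hu₂ => hu₁.unique hS hu₂⟩,
    hS.crossingSlopes_nonempty, hS.criticalSlope_pos,
    fun _ hα _ _ hu => hu.of_criticalSlope_lt hS hα,
    fun _ _ hu => hu.of_eq_criticalSlope hS,
    fun _ hα _ hu ⟨_, _, hfast⟩ => hu.eq_criticalSlope_of_fast hS hα hfast,
    fun _ hα hlt _ _ hu => hu.of_lt_criticalSlope hS hα hlt⟩
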